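/- Let $0\le d\le k$ and $B_{\max}\ge 1$ be integers and $p_{10},q\in[0,1]$. A memoryless channel turns the input bit $1$ into $0$ with probability $p_{10}$ and never changes a $0$. The receiver's energy usage $Z_1,Z_2,\dots$ is i.i.d. with $\Pr[Z_i=1]=q$, independent of the input and of the channel. With $Y_i$ the channel output, the battery starts at an arbitrary level $B_1=b_0\in\{0,\dots,B_{\max}\}$ and evolves by $B_{i+1}=\min(B_{\max},(B_i+Y_i-Z_i)^+)$; slot $i$ is an overflow ($O_i=1$) if $B_i=B_{\max},Y_i=1,Z_i=0$, and an underflow ($U_i=1$) if $B_i=0,Y_i=0,Z_i=1$. For a sequence of codes indexed by the blocklength $n$, with uniformly distributed message, $\Pr\{\mathcal O\}=\limsup_n\frac1n\sum_{i=1}^n E[O_i]$ and $\Pr\{\mathcal U\}=\limsup_n\frac1n\sum_{i=1}^n E[U_i]$. Fix $p_d,\dots,p_{k-1}\in(0,1)$. The code chain on the states $\{0,\dots,k\}$ goes from $j$ to $j+1$, emitting $0$, with probability $1$ if $j<d$ (and $j<k$), $p_j$ if $d\le j<k$ and $0$ if $j=k$, and otherwise goes to $0$, emitting $1$. It has a unique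 stationary distribution $\pi$. In the random code with $M_n$ messages the codewords of length $n$ are drawn independently, each being the output of the stationary code chain. Let $$p_I(i)=(1-p_{i-1})\prod_{l=d}^{i-2}p_l\ \ (d+1\le i\le k),\qquad p_I(k+1)=\prod_{l=d}^{k-1}p_l$$ be the law of the time $I$ between successive visits of the code chain to $0$ (renewals), $E[I]=\sum_{i=d+1}^{k+1} i\,p_I(i)$, and let $\tilde O_b$, $\tilde U_b$ be the numbers of overflows and underflows in a renewal interval started at battery level $b$. With $p(n;i,q)=\binom{i}{n}q^n(1-q)^{i-n}$, $$E[\tilde O_{B_{\max}}]=\sum_{i=d+1}^{k+1}p_I(i)(1-p_{10})\,p(0;i,q),$$ $$E[\tilde U_b]=\sum_{i=d+1}^{k+1}p_I(i)\Big\{(1-p_{10})\sum_{l=1}^{i-b-1} l\,p(l+b;i-1,q)+p_{10}\sum_{l=1}^{i-b} l\,p(l+b;i,q)\Big\}\quad(0\le b\le B_{\max}).$$ The Markov chain of the battery levels observed at the renewals has a stationary distribution. Let $\tilde\pi$ be any stationary distribution of it. Then, for every choice of the numbers $M_n\ge1$ of messages, the random code (averaging also over the code ensemble) has $$\Pr\{\mathcal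 O\}=\frac{\tilde\pi_{B_{\max}}E[\tilde O_{B_{\max}}]}{E[I]},\qquad \Pr\{\mathcal U\}=\frac{\sum_{b=0}^{B_{\max}}\tilde\pi_bE[\tilde U_b]}{E[I]}.$$ Moreover, with $H(a)=-a\log_2a-(1-a)\log_2(1-a)$, every triple $(R,P_{of},P_{uf})$ with $$0\le R\le R^*:=\sum_{j=d}^{k-1}\pi_j\{H((1-p_j)(1-p_{10}))-(1-p_j)H(p_{10})\},$$ $$P_{of}\ge\frac{\tilde\pi_{B_{\max}}E[\tilde O_{B_{\max}}]}{E[I]},\qquad P_{uf}\ge\frac{\sum_{b=0}^{B_{\max}}\tilde\pi_bE[\tilde U_b]}{E[I]}$$ is achievable: there are numbers $M_n$ of messages with $\frac1n\log_2M_n\to R$, namely $M_n=\lceil 2^{nR}\rceil$ for all $n$ if $R<R^*$, such that both (a) the random code with $M_n$ messages, with decoders that know the codebook, has ensemble-averaged error probability tending to $0$, $\Pr\{\mathcal O\}\le P_{of}$ and $\Pr\{\mathcal U\}\le P_{uf}$; and (b) there are deterministic codes with $M_n$ messages, all of whose codewords satisfy the type-0 $(d,k)$-RLL constraint (runs of $0$'s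 have length at most $k$, and runs of $0$'s between successive $1$'s have length at least $d$), and decoders, with error probability tending to $0$, $\Pr\{\mathcal O\}\le P_{of}$ and $\Pr\{\mathcal U\}\le P_{uf}$. -/

import Mathlib

open Filter Topology

namespace EnergyRLL

/-- Binary words of length `n`; `true` is the symbol 1 and `false` the symbol 0. -/
abbrev Word (n : ℕ) : Type := Fin n → Bool

/-- The type-0 `(d,k)`-RLL constraint: every run of 0's has length at most `k` (each window of
`k + 1` positions contains a 1), and every run of 0's between two successive 1's has length at
least `d`. -/
def IsRLL (d k : ℕ) {n : ℕ} (x : Word n) : Prop :=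
  (∀ s : ℕ, s + k < n → ∃ t : Fin n, s ≤ (t : ℕ) ∧ (t : ℕ) ≤ s + k ∧ x t = true) ∧
  (∀ s t : Fin n, s < t → x s = true → x t = true →
    (∀ r : Fin n, s < r → r < t → x r = false) → (s : ℕ) + d < t)

/-! ### Channel, energy usage, battery -/

/-- One use of the channel: 1 is received as 0 with probability `p10`, and 0 is always received
as 0. -/
def chan (p10 : ℝ) : Bool → Bool → ℝ
  | true, true => 1 - p10
  | true, false => p10
  | false, true => 0
  | false, false => 1

/-- Probability that the memoryless channel turns the word `x` into the word `y`. -/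
def chanProb (p10 : ℝ) {n : ℕ} (x y : Word n) : ℝ := ∏ i, chan p10 (x i) (y i)

/-- Probability of the usage pattern `z` when the usage process is i.i.d. with `Pr[Z = 1] = q`. -/
def usageProb (q : ℝ) {n : ℕ} (z : Word n) : ℝ := ∏ i, if z i = true then q else 1 - q

/-- Battery level before slot `i` (slots are numbered from 0), started from `b`:
`B (i+1) = min Bmax (B i + Y i - Z i)⁺`. The subtraction on `ℕ` is the truncated one, i.e. it
takes the positive part. -/
def battery (Bmax b : ℕ) {n : ℕ} (y z : Word n) : ℕ → ℕ
  | 0 => b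
  | i + 1 =>
    if h : i < n then
      min Bmax (battery Bmax b y z i + (y ⟨i, h⟩).toNat - (z ⟨i, h⟩).toNat)
    else battery Bmax b y z i

/-- Number of overflow events `{B i = Bmax, Y i = 1, Z i = 0}`. -/
def overflowCount (Bmax b : ℕ) {n : ℕ} (y z : Word n) : ℕ :=
  ∑ i : Fin n, if battery Bmax b y z i = Bmax ∧ y i = true ∧ z i = false then 1 else 0

/-- Number of underflow events `{B i = 0, Y i = 0, Z i = 1}`. -/
def underflowCount (Bmax b : ℕ) {n : ℕ} (y z : Word n) : ℕ :=
  ∑ i : Fin n, if battery Bmax b y z i = 0 ∧ y i = false ∧ z i = true then 1 else 0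

/-- Expectation of `f Y Z` when the word `x` is transmitted. -/
def energyMean (p10 q : ℝ) {n : ℕ} (x : Word n) (f : Word n → Word n → ℝ) : ℝ :=
  ∑ y, ∑ z, chanProb p10 x y * usageProb q z * f y z

/-- Expected number of overflows while `x` is transmitted, from initial battery level `b`. -/
def meanOverflows (p10 q : ℝ) (Bmax b : ℕ) {n : ℕ} (x : Word n) : ℝ :=
  energyMean p10 q x fun y z => (overflowCount Bmax b y z : ℝ)

/-- Expected number of underflows while `x` is transmitted, from initial battery level `b`. -/
def meanUnderflows (p10 q : ℝ) (Bmax b : ℕ) {n : ℕ} (x : Word n) : ℝ :=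
  energyMean p10 q x fun y z => (underflowCount Bmax b y z : ℝ)

/-! ### Codes: `M` equally likely messages, codewords `x m`, decoder `g` -/

/-- Probability of a decoding error. -/
noncomputable def errorProb (p10 : ℝ) {M n : ℕ} (x : Fin M → Word n) (g : Word n → Fin M) : ℝ :=
  (∑ m, ∑ y, if g y = m then 0 else chanProb p10 (x m) y) / M

/-- `(1/n) ∑_{i ≤ n} E[O i]` for a given codebook, averaged over the message. -/
noncomputable def overflowFreq (p10 q : ℝ) (Bmax b : ℕ) {M n : ℕ} (x : Fin M → Word n) : ℝ :=
  (∑ m, meanOverflows p10 q Bmax b (x m)) / M / n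

/-- `(1/n) ∑_{i ≤ n} E[U i]` for a given codebook, averaged over the message. -/
noncomputable def underflowFreq (p10 q : ℝ) (Bmax b : ℕ) {M n : ℕ} (x : Fin M → Word n) : ℝ :=
  (∑ m, meanUnderflows p10 q Bmax b (x m)) / M / n

/-- There are, for all blocklengths `n`, type-0 `(d,k)`-RLL codes with `M n` messages and decoders
with vanishing error probability, whose probabilities of overflow and of underflow are at most
`Pof` and `Puf`. -/
def CodesAchieve (d k : ℕ) (p10 q : ℝ) (Bmax b : ℕ) (M : ℕ → ℕ) (Pof Puf : ℝ) : Prop :=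
  ∃ (x : ∀ n, Fin (M n) → Word n) (g : ∀ n, Word n → Fin (M n)),
    (∀ n m, IsRLL d k (x n m)) ∧
    Tendsto (fun n => errorProb p10 (x n) (g n)) atTop (𝓝 0) ∧
    limsup (fun n => overflowFreq p10 q Bmax b (x n)) atTop ≤ Pof ∧
    limsup (fun n => underflowFreq p10 q Bmax b (x n)) atTop ≤ Puf

/-! ### The Markov chain on the constraint graph and the random code -/

/-- `π` is a stationary probability distribution of the chain with transition matrix `T`. -/
def IsStationaryDist {ι : Type*} [Fintype ι] (T : Matrix ι ι ℝ) (π : ι → ℝ) : Prop :=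
  π ∈ stdSimplex ℝ ι ∧ Matrix.vecMul π T = π

/-- Probability of emitting a 0, i.e. of moving from state `j` to state `j + 1`: forced for
`j < d`, equal to `p j` for `d ≤ j < k`, impossible in state `k`. -/
def zeroProb (d k : ℕ) (p : ℕ → ℝ) (j : ℕ) : ℝ :=
  if j < d then (if j < k then 1 else 0) else if j < k then p j else 0

/-- Transition matrix of the state `C` on `{0,…,k}`: from `i` to `i + 1` (symbol 0) or to `0`
(symbol 1). -/
def codeTrans (d k : ℕ) (p : ℕ → ℝ) : Matrix (Fin (k + 1)) (Fin (k + 1)) ℝ := fun i j =>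
  if (j : ℕ) = 0 then 1 - zeroProb d k p i
  else if (j : ℕ) = i + 1 then zeroProb d k p i else 0

/-- Law of a codeword `X` of length `n` read off the chain with initial distribution `π`:
`X i = 1` iff the state after slot `i` is `0`. -/
def wordProb (d k : ℕ) (p : ℕ → ℝ) (π : Fin (k + 1) → ℝ) {n : ℕ} (x : Word n) : ℝ :=
  ∑ c : Fin (n + 1) → Fin (k + 1),
    if ∀ i : Fin n, (x i = true ↔ c i.succ = 0) then
      π (c 0) * ∏ i : Fin n, codeTrans d k p (c i.castSucc) (c i.succ)
    else 0

/-- Average of `F` over random codebooks of `M` codewords drawn independently from `wordProb`. -/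
def ensembleMean (d k : ℕ) (p : ℕ → ℝ) (π : Fin (k + 1) → ℝ) {M n : ℕ}
    (F : (Fin M → Word n) → ℝ) : ℝ :=
  ∑ x : Fin M → Word n, (∏ m, wordProb d k p π (x m)) * F x

/-- Probability of overflow of the random code with `M n` codewords of length `n`. -/
noncomputable def ensembleOverflowProb (d k : ℕ) (p : ℕ → ℝ) (π : Fin (k + 1) → ℝ) (p10 q : ℝ)
    (Bmax b : ℕ) (M : ℕ → ℕ) : ℝ :=
  limsup (fun n => ensembleMean d k p π fun x : Fin (M n) → Word n =>
    overflowFreq p10 q Bmax b x) atTop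

/-- Probability of underflow of the random code with `M n` codewords of length `n`. -/
noncomputable def ensembleUnderflowProb (d k : ℕ) (p : ℕ → ℝ) (π : Fin (k + 1) → ℝ) (p10 q : ℝ)
    (Bmax b : ℕ) (M : ℕ → ℕ) : ℝ :=
  limsup (fun n => ensembleMean d k p π fun x : Fin (M n) → Word n =>
    underflowFreq p10 q Bmax b x) atTop

/-- The random code with `M n` codewords of length `n`, and decoders which know the codebook, has
vanishing error probability and probabilities of overflow and underflow at most `Pof` and `Puf`,
on average over the ensemble. -/
def RandomCodeAchieves (d k : ℕ) (p : ℕ → ℝ) (π : Fin (k + 1) → ℝ) (p10 q : ℝ)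
    (Bmax b : ℕ) (M : ℕ → ℕ) (Pof Puf : ℝ) : Prop :=
  (∃ g : ∀ n, (Fin (M n) → Word n) → Word n → Fin (M n),
    Tendsto (fun n => ensembleMean d k p π fun x : Fin (M n) → Word n =>
      errorProb p10 x (g n x)) atTop (𝓝 0)) ∧
  ensembleOverflowProb d k p π p10 q Bmax b M ≤ Pof ∧
  ensembleUnderflowProb d k p π p10 q Bmax b M ≤ Puf

/-- Binary entropy function in bits. -/
noncomputable def binH (a : ℝ) : ℝ := -a * Real.logb 2 a - (1 - a) * Real.logb 2 (1 - a)

/-- `∑_{j=d}^{k-1} π_j {H((1-p_j)(1-p10)) - (1-p_j) H(p10)}`. -/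
noncomputable def rateBound (d k : ℕ) (p : ℕ → ℝ) (π : Fin (k + 1) → ℝ) (p10 : ℝ) : ℝ :=
  ∑ j ∈ Finset.univ.filter (fun j : Fin (k + 1) => d ≤ (j : ℕ) ∧ (j : ℕ) < k),
    π j * (binH ((1 - p j) * (1 - p10)) - (1 - p j) * binH p10)

/-! ### Renewal intervals (between successive visits of the code state to 0) -/

/-- Distribution `p_I` of the length of a renewal interval. -/
def intervalProb (d k : ℕ) (p : ℕ → ℝ) (i : ℕ) : ℝ :=
  if i ≤ d ∨ k + 1 < i then 0
  else if i = k + 1 then ∏ l ∈ Finset.Ico d k, p l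
  else (1 - p (i - 1)) * ∏ l ∈ Finset.Ico d (i - 1), p l

/-- `E[I]`. -/
def meanInterval (d k : ℕ) (p : ℕ → ℝ) : ℝ :=
  ∑ i ∈ Finset.Icc (d + 1) (k + 1), (i : ℝ) * intervalProb d k p i

/-- The word `0⋯01` transmitted during a renewal interval of length `i`. -/
def renewalWord (i : ℕ) : Word i := fun t => decide ((t : ℕ) + 1 = i)

/-- Transition matrix of the battery level observed at the renewal instants. -/
def renewalTrans (d k : ℕ) (p : ℕ → ℝ) (p10 q : ℝ) (Bmax : ℕ) :
    Matrix (Fin (Bmax + 1)) (Fin (Bmax + 1)) ℝ := fun b b' =>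
  ∑ i ∈ Finset.Icc (d + 1) (k + 1), intervalProb d k p i *
    energyMean p10 q (renewalWord i) fun y z => if battery Bmax b y z i = b' then 1 else 0

/-- `E[Õ_b]`: expected number of overflows in a renewal interval that starts at level `b`. -/
def renewalOverflows (d k : ℕ) (p : ℕ → ℝ) (p10 q : ℝ) (Bmax b : ℕ) : ℝ :=
  ∑ i ∈ Finset.Icc (d + 1) (k + 1), intervalProb d k p i *
    meanOverflows p10 q Bmax b (renewalWord i)

/-- `E[Ũ_b]`: expected number of underflows in a renewal interval that starts at level `b`. -/
def renewalUnderflows (d k : ℕ) (p : ℕ → ℝ) (p10 q : ℝ) (Bmax b : ℕ) : ℝ :=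
  ∑ i ∈ Finset.Icc (d + 1) (k + 1), intervalProb d k p i *
    meanUnderflows p10 q Bmax b (renewalWord i)

/-- Binomial probability `p(n; i, q) = (i choose n) q^n (1-q)^(i-n)`. -/
def binom (n i : ℕ) (q : ℝ) : ℝ := (i.choose n : ℝ) * q ^ n * (1 - q) ^ (i - n)

/-- `π̃_{Bmax} E[Õ_{Bmax}] / E[I]`. -/
noncomputable def overflowBound (d k : ℕ) (p : ℕ → ℝ) (p10 q : ℝ) (Bmax : ℕ)
    (πB : Fin (Bmax + 1) → ℝ) : ℝ :=
  πB (Fin.last Bmax) * renewalOverflows d k p p10 q Bmax Bmax / meanInterval d k p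

/-- `∑_b π̃_b E[Ũ_b] / E[I]`. -/
noncomputable def underflowBound (d k : ℕ) (p : ℕ → ℝ) (p10 q : ℝ) (Bmax : ℕ)
    (πB : Fin (Bmax + 1) → ℝ) : ℝ :=
  (∑ b : Fin (Bmax + 1), πB b * renewalUnderflows d k p p10 q Bmax b) / meanInterval d k p

end EnergyRLL

open EnergyRLL

namespace EnergyRLL

/-! Code state and battery level together form a Markov chain, and overflows, underflows and
information density are additive rewards along it. Everything rests on one fact about such a reward:
from any initial state, the sum over `n` slots has mean `n g + O(1)` and mean square deviation
`O(n)` from `n g`, where `g` is the mean reward of a renewal cycle divided by the mean cycle length.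

For the mean, the occupation measure of a cycle whose initial battery law is stationary is invariant
(`cycleSum_next`), so integrating the `n`-slot mean against it gives exactly `n` times the cycle
reward (`cycleSum_meanReward`). On the other hand the `n`-slot means from any two states differ by a
bounded amount: the code state soon returns to 0 (`abs_meanReward_sub_renewal_le`), and two
batteries driven by the same outputs and usages have counts that differ by at most the gap of their
initial levels (`abs_overflowReward_sub_add_le`, `abs_underflowReward_sub_add_le`). Hence each mean
is close to `n g` (`abs_meanReward_sub_linear_le`). The battery chain need not be ergodic, which is
why any stationary law may be used. The variance bound follows by peeling off slots
(`blockMean_sq_rewardSum_sub_le`).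

For coding, the product of slotwise likelihood ratios has mean at most one over an independent
codeword, and its logarithm is an additive reward with `g = R*`. Chebyshev's inequality and
threshold decoding (`exists_decoder`) give vanishing error. The decoder does not know the initial
code state, so its metric averages the ratio over the posterior law of that state; this costs a
subexponential factor (`metric_lt_prob_le`). The endpoint `R = R*` is reached by rates that approach
it slowly from below.

For deterministic codes, the error probability plus the squared deviations of both frequencies has
vanishing ensemble mean. A codebook of positive probability no worse than this mean is good in all
three respects, and its codewords satisfy the runlength constraint (`isRLL_of_wordProb_pos`).

The closed formulas hold because a battery is never charged during the 0's of a renewal interval: it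
can overflow only in the last slot, and its underflows are the excess of a binomial number of usages
over the initial level. -/

/-! ### Recursive description of the code chain, the channel and the battery -/

/-- The code state after a symbol is emitted from state `c`. -/
def nextState (c : ℕ) : Bool → ℕ
  | true => 0
  | false => c + 1

/-- Probability of emitting a symbol in state `c`, when `z c` is the probability of a 0. -/
def symProb (z : ℕ → ℝ) (c : ℕ) : Bool → ℝ
  | true => 1 - z c
  | false => z c

/-- Law of the energy usage of one slot. -/
def useProb (q : ℝ) (u : Bool) : ℝ := if u = true then q else 1 - q

/-- Battery level after one slot. -/
def batteryStep (Bmax b : ℕ) (y u : Bool) : ℕ := min Bmax (b + y.toNat - u.toNat)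

theorem batteryStep_le (Bmax b : ℕ) (y u : Bool) : batteryStep Bmax b y u ≤ Bmax :=
  min_le_left _ _

/-- Joint law of the input, the output and the usage of a slot, in code state `c`. -/
def slotProb (z : ℕ → ℝ) (p10 q : ℝ) (c : ℕ) (ω : Bool × Bool × Bool) : ℝ :=
  symProb z c ω.1 * (chan p10 ω.1 ω.2.1 * useProb q ω.2.2)

/-- Probability of a word emitted by the code chain started in state `c`. -/
def wordProbFrom (z : ℕ → ℝ) : ∀ {n : ℕ}, ℕ → Word n → ℝ
  | 0, _, _ => 1
  | _ + 1, c, x => symProb z c (x 0) * wordProbFrom z (nextState c (x 0)) (Fin.tail x)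

/-- Expectation over a block of `n` slots, from code state `c`. -/
def blockMean (z : ℕ → ℝ) (p10 q : ℝ) {n : ℕ} (c : ℕ) (f : Word n → Word n → Word n → ℝ) : ℝ :=
  ∑ x, wordProbFrom z c x * energyMean p10 q x (f x)

/-- Total reward collected over a block, from code state `c` and battery level `b`. -/
def rewardSum (Bmax : ℕ) (r : ℕ → ℕ → Bool × Bool × Bool → ℝ) :
    ∀ {n : ℕ}, ℕ → ℕ → Word n → Word n → Word n → ℝ
  | 0, _, _, _, _, _ => 0
  | _ + 1, c, b, x, y, u => r c b (x 0, y 0, u 0) +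
      rewardSum Bmax r (nextState c (x 0)) (batteryStep Bmax b (y 0) (u 0))
        (Fin.tail x) (Fin.tail y) (Fin.tail u)

theorem sum_fin_succ_pi {α β : Type*} [Fintype α] [AddCommMonoid β] {n : ℕ}
    (f : (Fin (n + 1) → α) → β) :
    ∑ w, f w = ∑ a, ∑ w : Fin n → α, f (Fin.cons a w) := by
  rw [← (Fin.consEquiv fun _ => α).sum_comp, Fintype.sum_prod_type]
  rfl

@[simp] theorem wordProbFrom_cons (z : ℕ → ℝ) {n : ℕ} (c : ℕ) (a : Bool) (x : Word n) :
    wordProbFrom z c (Fin.cons a x : Word (n + 1)) =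
      symProb z c a * wordProbFrom z (nextState c a) x := by
  simp [wordProbFrom]

@[simp] theorem rewardSum_cons (Bmax : ℕ) (r : ℕ → ℕ → Bool × Bool × Bool → ℝ) {n : ℕ} (c b : ℕ)
    (a e s : Bool) (x y u : Word n) :
    rewardSum Bmax r c b (Fin.cons a x : Word (n + 1)) (Fin.cons e y : Word (n + 1))
      (Fin.cons s u : Word (n + 1)) =
      r c b (a, e, s) + rewardSum Bmax r (nextState c a) (batteryStep Bmax b e s) x y u := by
  simp [rewardSum]

theorem chanProb_cons (p10 : ℝ) {n : ℕ} (a e : Bool) (x y : Word n) :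
    chanProb p10 (Fin.cons a x : Word (n + 1)) (Fin.cons e y : Word (n + 1)) =
      chan p10 a e * chanProb p10 x y := by
  simp [chanProb, Fin.prod_univ_succ]

theorem usageProb_cons (q : ℝ) {n : ℕ} (s : Bool) (u : Word n) :
    usageProb q (Fin.cons s u : Word (n + 1)) = useProb q s * usageProb q u := by
  simp [usageProb, useProb, Fin.prod_univ_succ]

theorem energyMean_cons (p10 q : ℝ) {n : ℕ} (a : Bool) (x : Word n)
    (f : Word (n + 1) → Word (n + 1) → ℝ) :
    energyMean p10 q (Fin.cons a x : Word (n + 1)) f =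
      ∑ ω : Bool × Bool, chan p10 a ω.1 * useProb q ω.2 *
        energyMean p10 q x fun y u => f (Fin.cons ω.1 y) (Fin.cons ω.2 u) := by
  unfold energyMean
  rw [sum_fin_succ_pi, Fintype.sum_prod_type]
  refine Finset.sum_congr rfl fun e _ => ?_
  simp only [sum_fin_succ_pi (α := Bool) (β := ℝ), Finset.mul_sum]
  rw [Finset.sum_comm]
  refine Finset.sum_congr rfl fun s _ => Finset.sum_congr rfl fun y _ =>
    Finset.sum_congr rfl fun u _ => ?_
  rw [chanProb_cons, usageProb_cons]
  ring

theorem energyMean_zero (p10 q : ℝ) (x : Word 0) (f : Word 0 → Word 0 → ℝ) :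
    energyMean p10 q x f = f Fin.elim0 Fin.elim0 := by
  simp [energyMean, chanProb, usageProb]
  congr 1

theorem blockMean_zero (z : ℕ → ℝ) (p10 q : ℝ) (c : ℕ) (f : Word 0 → Word 0 → Word 0 → ℝ) :
    blockMean z p10 q c f = f Fin.elim0 Fin.elim0 Fin.elim0 := by
  simp [blockMean, energyMean_zero, wordProbFrom]
  congr 1

theorem blockMean_succ (z : ℕ → ℝ) (p10 q : ℝ) {n : ℕ} (c : ℕ)
    (f : Word (n + 1) → Word (n + 1) → Word (n + 1) → ℝ) :
    blockMean z p10 q c f = ∑ ω, slotProb z p10 q c ω *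
      blockMean z p10 q (nextState c ω.1) fun x y u : Word n =>
        f (Fin.cons ω.1 x) (Fin.cons ω.2.1 y) (Fin.cons ω.2.2 u) := by
  unfold blockMean
  rw [sum_fin_succ_pi, Fintype.sum_prod_type]
  refine Finset.sum_congr rfl fun a _ => ?_
  simp only [energyMean_cons, wordProbFrom_cons, Finset.mul_sum]
  rw [Finset.sum_comm]
  refine Finset.sum_congr rfl fun s _ => Finset.sum_congr rfl fun x _ => ?_
  simp only [slotProb]
  ring

/-! ### Linearity and positivity of the expectations -/

theorem energyMean_add (p10 q : ℝ) {n : ℕ} (x : Word n) (f g : Word n → Word n → ℝ) :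
    energyMean p10 q x (fun y u => f y u + g y u) = energyMean p10 q x f + energyMean p10 q x g := by
  simp only [energyMean, mul_add, Finset.sum_add_distrib]

theorem energyMean_const_mul (p10 q : ℝ) {n : ℕ} (x : Word n) (a : ℝ) (f : Word n → Word n → ℝ) :
    energyMean p10 q x (fun y u => a * f y u) = a * energyMean p10 q x f := by
  simp only [energyMean, Finset.mul_sum]
  refine Finset.sum_congr rfl fun _ _ => Finset.sum_congr rfl fun _ _ => by ring

theorem chan_nonneg {p10 : ℝ} (hp : p10 ∈ Set.Icc (0 : ℝ) 1) (a e : Bool) : 0 ≤ chan p10 a e := by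
  obtain ⟨h0, h1⟩ := hp
  cases a <;> cases e <;> simp [chan] <;> linarith

theorem useProb_nonneg {q : ℝ} (hq : q ∈ Set.Icc (0 : ℝ) 1) (u : Bool) : 0 ≤ useProb q u := by
  obtain ⟨h0, h1⟩ := hq
  cases u <;> simp [useProb] <;> linarith

theorem symProb_nonneg {z : ℕ → ℝ} (hz : ∀ c, z c ∈ Set.Icc (0 : ℝ) 1) (c : ℕ) (a : Bool) :
    0 ≤ symProb z c a := by
  obtain ⟨h0, h1⟩ := hz c
  cases a <;> simp [symProb] <;> linarith

theorem chanProb_nonneg {p10 : ℝ} (hp : p10 ∈ Set.Icc (0 : ℝ) 1) {n : ℕ} (x y : Word n) :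
    0 ≤ chanProb p10 x y :=
  Finset.prod_nonneg fun _ _ => chan_nonneg hp _ _

theorem usageProb_nonneg {q : ℝ} (hq : q ∈ Set.Icc (0 : ℝ) 1) {n : ℕ} (u : Word n) :
    0 ≤ usageProb q u :=
  Finset.prod_nonneg fun i _ => useProb_nonneg hq (u i)

theorem slotProb_nonneg {z : ℕ → ℝ} {p10 q : ℝ} (hz : ∀ c, z c ∈ Set.Icc (0 : ℝ) 1)
    (hp : p10 ∈ Set.Icc (0 : ℝ) 1) (hq : q ∈ Set.Icc (0 : ℝ) 1) (c : ℕ)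
    (ω : Bool × Bool × Bool) : 0 ≤ slotProb z p10 q c ω :=
  mul_nonneg (symProb_nonneg hz _ _) (mul_nonneg (chan_nonneg hp _ _) (useProb_nonneg hq _))

theorem sum_chan_mul_useProb (p10 q : ℝ) (a : Bool) :
    ∑ ω : Bool × Bool, chan p10 a ω.1 * useProb q ω.2 = 1 := by
  cases a <;> simp [Fintype.sum_prod_type, chan, useProb]
  ring

theorem sum_slotProb (z : ℕ → ℝ) (p10 q : ℝ) (c : ℕ) : ∑ ω, slotProb z p10 q c ω = 1 := by
  rw [Fintype.sum_prod_type]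
  simp only [slotProb, ← Finset.mul_sum, sum_chan_mul_useProb]
  simp [symProb]

theorem wordProbFrom_nonneg {z : ℕ → ℝ} (hz : ∀ c, z c ∈ Set.Icc (0 : ℝ) 1) :
    ∀ {n : ℕ} (c : ℕ) (x : Word n), 0 ≤ wordProbFrom z c x
  | 0, _, _ => zero_le_one
  | _ + 1, c, x => mul_nonneg (symProb_nonneg hz c (x 0)) (wordProbFrom_nonneg hz _ _)

theorem sum_wordProbFrom (z : ℕ → ℝ) : ∀ (n : ℕ) (c : ℕ), ∑ x : Word n, wordProbFrom z c x = 1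
  | 0, _ => by simp [wordProbFrom]
  | n + 1, c => by
    rw [sum_fin_succ_pi]
    simp only [wordProbFrom_cons, ← Finset.mul_sum, sum_wordProbFrom z n]
    simp [symProb]

theorem energyMean_const (p10 q : ℝ) (a : ℝ) :
    ∀ {n : ℕ} (x : Word n), energyMean p10 q x (fun _ _ => a) = a
  | 0, x => by rw [energyMean_zero]
  | n + 1, x => by
    rw [← Fin.cons_self_tail x, energyMean_cons]
    simp only [energyMean_const p10 q a, ← Finset.sum_mul, sum_chan_mul_useProb, one_mul]

theorem blockMean_const (z : ℕ → ℝ) (p10 q : ℝ) {n : ℕ} (c : ℕ) (a : ℝ) :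
    blockMean z p10 q c (fun _ _ _ : Word n => a) = a := by
  simp only [blockMean, energyMean_const, ← Finset.sum_mul, sum_wordProbFrom, one_mul]

theorem energyMean_mono {p10 q : ℝ} (hp : p10 ∈ Set.Icc (0 : ℝ) 1) (hq : q ∈ Set.Icc (0 : ℝ) 1)
    {n : ℕ} (x : Word n) {f g : Word n → Word n → ℝ} (h : ∀ y u, f y u ≤ g y u) :
    energyMean p10 q x f ≤ energyMean p10 q x g :=
  Finset.sum_le_sum fun _ _ => Finset.sum_le_sum fun _ _ =>
    mul_le_mul_of_nonneg_left (h _ _)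
      (mul_nonneg (chanProb_nonneg hp _ _) (usageProb_nonneg hq _))

theorem blockMean_add (z : ℕ → ℝ) (p10 q : ℝ) {n : ℕ} (c : ℕ)
    (f g : Word n → Word n → Word n → ℝ) :
    blockMean z p10 q c (fun x y u => f x y u + g x y u) =
      blockMean z p10 q c f + blockMean z p10 q c g := by
  simp only [blockMean, energyMean_add, mul_add, Finset.sum_add_distrib]

theorem blockMean_const_mul (z : ℕ → ℝ) (p10 q : ℝ) {n : ℕ} (c : ℕ) (a : ℝ)
    (f : Word n → Word n → Word n → ℝ) :
    blockMean z p10 q c (fun x y u => a * f x y u) = a * blockMean z p10 q c f := by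
  simp only [blockMean, energyMean_const_mul, Finset.mul_sum]
  exact Finset.sum_congr rfl fun _ _ => by ring

/-! ### Counts of overflows and underflows as reward sums -/

theorem battery_cons (Bmax b : ℕ) {n : ℕ} (e s : Bool) (y u : Word n) (i : ℕ) :
    battery Bmax b (Fin.cons e y : Word (n + 1)) (Fin.cons s u : Word (n + 1)) (i + 1) =
      battery Bmax (batteryStep Bmax b e s) y u i := by
  induction i with
  | zero => simp [battery, batteryStep]
  | succ i ih =>
    rw [battery, ih, battery]
    by_cases h : i < n
    · rw [dif_pos h, dif_pos (Nat.succ_lt_succ h)]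
      rfl
    · simp [h]

/-- Indicator of an overflow in a slot. -/
def overflowReward (Bmax b : ℕ) (y u : Bool) : ℝ :=
  if b = Bmax ∧ y = true ∧ u = false then 1 else 0

/-- Indicator of an underflow in a slot. -/
def underflowReward (b : ℕ) (y u : Bool) : ℝ :=
  if b = 0 ∧ y = false ∧ u = true then 1 else 0

theorem overflowCount_eq_rewardSum (Bmax : ℕ) : ∀ {n : ℕ} (c b : ℕ) (x y u : Word n),
    (overflowCount Bmax b y u : ℝ) =
      rewardSum Bmax (fun _ b ω => overflowReward Bmax b ω.2.1 ω.2.2) c b x y u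
  | 0, _, _, _, _, _ => by simp [overflowCount, rewardSum]
  | n + 1, c, b, x, y, u => by
    rw [← Fin.cons_self_tail x, ← Fin.cons_self_tail y, ← Fin.cons_self_tail u, rewardSum_cons,
      ← overflowCount_eq_rewardSum Bmax]
    simp only [overflowCount, Fin.sum_univ_succ, Fin.val_succ, battery_cons]
    simp [overflowReward, battery]

theorem underflowCount_eq_rewardSum (Bmax : ℕ) : ∀ {n : ℕ} (c b : ℕ) (x y u : Word n),
    (underflowCount Bmax b y u : ℝ) =
      rewardSum Bmax (fun _ b ω => underflowReward b ω.2.1 ω.2.2) c b x y u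
  | 0, _, _, _, _, _ => by simp [underflowCount, rewardSum]
  | n + 1, c, b, x, y, u => by
    rw [← Fin.cons_self_tail x, ← Fin.cons_self_tail y, ← Fin.cons_self_tail u, rewardSum_cons,
      ← underflowCount_eq_rewardSum Bmax]
    simp only [underflowCount, Fin.sum_univ_succ, Fin.val_succ, battery_cons]
    simp [underflowReward, battery]

/-! ### The law of a codeword -/

theorem zeroProb_mem {d k : ℕ} {p : ℕ → ℝ} (hp : ∀ j, d ≤ j → j < k → p j ∈ Set.Ioo (0 : ℝ) 1)
    (c : ℕ) : zeroProb d k p c ∈ Set.Icc (0 : ℝ) 1 := by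
  unfold zeroProb
  split_ifs with h1 h2 h3
  · simp
  · simp
  · exact Set.Ioo_subset_Icc_self (hp c (not_lt.1 h1) h3)
  · simp

theorem zeroProb_of_le {d k : ℕ} (p : ℕ → ℝ) {c : ℕ} (h : k ≤ c) : zeroProb d k p c = 0 := by
  simp [zeroProb, not_lt.2 h]

/-- The word and the starting state leave at most one path of nonzero weight: a 1 leads to state 0
and a 0 to the successor. This turns the sum over paths into a recursion on the first symbol. -/
theorem sum_codePaths (d k : ℕ) (p : ℕ → ℝ) : ∀ {n : ℕ} (c0 : Fin (k + 1)) (x : Word n),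
    (∑ c : Fin n → Fin (k + 1), if ∀ i : Fin n, (x i = true ↔ c i = 0) then
      ∏ i : Fin n, codeTrans d k p ((Fin.cons c0 c : Fin (n + 1) → Fin (k + 1)) i.castSucc) (c i)
      else 0) = wordProbFrom (zeroProb d k p) c0 x
  | 0, c0, x => by simp [wordProbFrom]
  | n + 1, c0, x => by
    rw [← Fin.cons_self_tail x, wordProbFrom_cons, sum_fin_succ_pi]
    generalize x 0 = a
    generalize Fin.tail x = x'
    have key : ∀ c1 : Fin (k + 1), (∑ c : Fin n → Fin (k + 1),
        if ∀ i : Fin (n + 1), ((Fin.cons a x' : Word (n + 1)) i = true ↔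
          (Fin.cons c1 c : Fin (n + 1) → Fin (k + 1)) i = 0) then
        ∏ i : Fin (n + 1), codeTrans d k p
          ((Fin.cons c0 (Fin.cons c1 c : Fin (n + 1) → Fin (k + 1)) :
            Fin (n + 2) → Fin (k + 1)) i.castSucc)
          ((Fin.cons c1 c : Fin (n + 1) → Fin (k + 1)) i)
        else 0) = if (a = true ↔ c1 = 0) then
          codeTrans d k p c0 c1 * wordProbFrom (zeroProb d k p) c1 x' else 0 := by
      intro c1
      rw [← sum_codePaths d k p c1 x', Finset.mul_sum]
      split_ifs with h
      · refine Finset.sum_congr rfl fun c _ => ?_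
        simp only [Fin.forall_fin_succ, Fin.cons_zero, Fin.cons_succ, h, true_and,
          Fin.prod_univ_succ, Fin.castSucc_zero, ← Fin.succ_castSucc]
        split_ifs <;> simp
      · refine Finset.sum_eq_zero fun c _ => if_neg fun h' => h ?_
        simpa using h' 0
    rw [Finset.sum_congr rfl fun c1 _ => key c1]
    cases a with
    | true =>
      simp only [true_iff, Finset.sum_ite_eq', Finset.mem_univ, if_true]
      simp [codeTrans, symProb, nextState]
    | false =>
      -- State `k` has no successor in `Fin (k + 1)`; the recursion with states in `ℕ` agrees there
      -- because a 0 has probability zero.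
      by_cases hk : (c0 : ℕ) < k
      · rw [Finset.sum_eq_single (⟨c0 + 1, Nat.succ_lt_succ hk⟩ : Fin (k + 1))]
        · have h0 : (⟨c0 + 1, Nat.succ_lt_succ hk⟩ : Fin (k + 1)) ≠ 0 := fun h => by
            simpa using congrArg Fin.val h
          simp [codeTrans, symProb, nextState, h0]
        · intro c1 _ h1
          have h1' : (c1 : ℕ) ≠ c0 + 1 := fun h => h1 (Fin.ext h)
          by_cases h0 : c1 = 0
          · simp [h0]
          · have h0' : (c1 : ℕ) ≠ 0 := fun h => h0 (Fin.ext h)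
            simp [codeTrans, h0', h1']
        · simp
      · have hz : zeroProb d k p c0 = 0 := zeroProb_of_le p (not_lt.1 hk)
        simp only [symProb, hz, zero_mul]
        refine Finset.sum_eq_zero fun c1 _ => ?_
        by_cases h0 : c1 = 0
        · simp [h0]
        · have h0' : (c1 : ℕ) ≠ 0 := fun h => h0 (Fin.ext h)
          simp [codeTrans, h0', hz]

theorem wordProb_eq_sum (d k : ℕ) (p : ℕ → ℝ) (π : Fin (k + 1) → ℝ) {n : ℕ} (x : Word n) :
    wordProb d k p π x = ∑ c, π c * wordProbFrom (zeroProb d k p) c x := by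
  rw [wordProb, sum_fin_succ_pi]
  refine Finset.sum_congr rfl fun c0 _ => ?_
  rw [← sum_codePaths, Finset.mul_sum]
  refine Finset.sum_congr rfl fun c _ => ?_
  simp

/-! ### Mean rewards along the joint chain of code state and battery -/

/-- Expected reward of a block of `n` slots. -/
def meanReward (z : ℕ → ℝ) (p10 q : ℝ) (Bmax : ℕ) (r : ℕ → ℕ → Bool × Bool × Bool → ℝ)
    (n c b : ℕ) : ℝ :=
  blockMean z p10 q c (rewardSum Bmax r c b : Word n → Word n → Word n → ℝ)

section MeanReward

variable {z : ℕ → ℝ} {p10 q : ℝ} {Bmax : ℕ} {r : ℕ → ℕ → Bool × Bool × Bool → ℝ}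

theorem meanReward_zero (c b : ℕ) : meanReward z p10 q Bmax r 0 c b = 0 := by
  simp [meanReward, rewardSum, blockMean_const]

theorem meanReward_succ (n c b : ℕ) :
    meanReward z p10 q Bmax r (n + 1) c b = ∑ ω, slotProb z p10 q c ω *
      (r c b ω + meanReward z p10 q Bmax r n (nextState c ω.1)
        (batteryStep Bmax b ω.2.1 ω.2.2)) := by
  simp only [meanReward, blockMean_succ, rewardSum_cons, blockMean_add, blockMean_const]

/-- Discarding outcomes of probability zero is what allows forced symbols to be exploited later. -/
theorem abs_sum_slotProb_mul_sub_le (hz : ∀ c, z c ∈ Set.Icc (0 : ℝ) 1)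
    (hp : p10 ∈ Set.Icc (0 : ℝ) 1) (hq : q ∈ Set.Icc (0 : ℝ) 1) (c : ℕ)
    {f : Bool × Bool × Bool → ℝ} {a K : ℝ}
    (h : ∀ ω, slotProb z p10 q c ω ≠ 0 → |f ω - a| ≤ K) :
    |∑ ω, slotProb z p10 q c ω * f ω - a| ≤ K := by
  have h1 : ∑ ω, slotProb z p10 q c ω * f ω - a = ∑ ω, slotProb z p10 q c ω * (f ω - a) := by
    simp only [mul_sub, Finset.sum_sub_distrib, ← Finset.sum_mul, sum_slotProb, one_mul]
  rw [h1]
  calc |∑ ω, slotProb z p10 q c ω * (f ω - a)|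
      ≤ ∑ ω, |slotProb z p10 q c ω * (f ω - a)| := Finset.abs_sum_le_sum_abs _ _
    _ ≤ ∑ ω, slotProb z p10 q c ω * K := by
        refine Finset.sum_le_sum fun ω _ => ?_
        have h0 := slotProb_nonneg hz hp hq c ω
        rw [abs_mul, abs_of_nonneg h0]
        by_cases h2 : slotProb z p10 q c ω = 0
        · simp [h2]
        · exact mul_le_mul_of_nonneg_left (h ω h2) h0
    _ = K := by rw [← Finset.sum_mul, sum_slotProb, one_mul]

variable {k : ℕ} {K L : ℝ}

/-- After the first slot is peeled from both blocks, its reward cancels; what remains is an average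
of the same difference for shorter blocks, down to a single reward. -/
theorem abs_meanReward_succ_sub_le (hz : ∀ c, z c ∈ Set.Icc (0 : ℝ) 1)
    (hp : p10 ∈ Set.Icc (0 : ℝ) 1) (hq : q ∈ Set.Icc (0 : ℝ) 1)
    (hK : ∀ c b ω, |r c b ω| ≤ K) (n c b : ℕ) :
    |meanReward z p10 q Bmax r (n + 1) c b - meanReward z p10 q Bmax r n c b| ≤ K := by
  induction n generalizing c b with
  | zero =>
    rw [meanReward_succ, meanReward_zero]
    refine abs_sum_slotProb_mul_sub_le hz hp hq c fun ω _ => ?_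
    rw [meanReward_zero, add_zero, sub_zero]
    exact hK c b ω
  | succ n ih =>
    rw [meanReward_succ, meanReward_succ n, ← Finset.sum_sub_distrib, ← sub_zero (∑ ω, _)]
    simp only [← mul_sub]
    refine abs_sum_slotProb_mul_sub_le hz hp hq c fun ω _ => ?_
    rw [sub_zero, add_sub_add_left_eq_sub]
    exact ih _ _

/-- Induction on the number `j` of further 0's that are possible. Each slot before the renewal costs
`K` for its own reward and `K` for shortening the block that is compared with. At the renewal the
code states agree and `hL` absorbs the battery difference. No bound on `b` is needed, since one slot
brings the level below `Bmax`. -/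
theorem abs_meanReward_sub_renewal_le (hz : ∀ c, z c ∈ Set.Icc (0 : ℝ) 1)
    (hzk : ∀ c, k ≤ c → z c = 0)
    (hp : p10 ∈ Set.Icc (0 : ℝ) 1) (hq : q ∈ Set.Icc (0 : ℝ) 1)
    (hK : ∀ c b ω, |r c b ω| ≤ K)
    (hL : ∀ n c b b', b ≤ Bmax → b' ≤ Bmax →
      |meanReward z p10 q Bmax r n c b - meanReward z p10 q Bmax r n c b'| ≤ L)
    (j : ℕ) : ∀ c, k ≤ c + j → ∀ n b b', b' ≤ Bmax →
      |meanReward z p10 q Bmax r n c b - meanReward z p10 q Bmax r n 0 b'| ≤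
        2 * K * (j + 1) + L := by
  have hK0 : 0 ≤ K := (abs_nonneg _).trans (hK 0 0 (true, true, true))
  have hL0 : 0 ≤ L := (abs_nonneg _).trans (hL 0 0 0 0 (Nat.zero_le _) (Nat.zero_le _))
  induction j with
  | zero =>
    intro c hc n b b' hb'
    cases n with
    | zero => simp only [meanReward_zero, sub_self, abs_zero]; positivity
    | succ n =>
      have h1 := abs_meanReward_succ_sub_le (Bmax := Bmax) hz hp hq hK n 0 b'
      have h2 : |meanReward z p10 q Bmax r (n + 1) c b - meanReward z p10 q Bmax r n 0 b'| ≤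
          K + L := by
        rw [meanReward_succ]
        refine abs_sum_slotProb_mul_sub_le hz hp hq c fun ω hω => ?_
        obtain ⟨a, e, s⟩ := ω
        cases a with
        -- In a state `c ≥ k` a 0 is impossible, so the next slot is a renewal.
        | false => simp [slotProb, symProb, hzk c hc] at hω
        | true =>
          rw [add_sub_assoc]
          exact (abs_add_le _ _).trans (add_le_add (hK _ _ _)
            (hL _ _ _ _ (batteryStep_le _ _ _ _) hb'))
      rw [abs_sub_comm] at h1
      have h3 := abs_sub_le (meanReward z p10 q Bmax r (n + 1) c b)
        (meanReward z p10 q Bmax r n 0 b') (meanReward z p10 q Bmax r (n + 1) 0 b')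
      push_cast
      linarith
  | succ j ih =>
    intro c hc n b b' hb'
    cases n with
    | zero => simp only [meanReward_zero, sub_self, abs_zero]; positivity
    | succ n =>
      have h1 := abs_meanReward_succ_sub_le (Bmax := Bmax) hz hp hq hK n 0 b'
      have h2 : |meanReward z p10 q Bmax r (n + 1) c b - meanReward z p10 q Bmax r n 0 b'| ≤
          K + (2 * K * (j + 1) + L) := by
        rw [meanReward_succ]
        refine abs_sum_slotProb_mul_sub_le hz hp hq c fun ω hω => ?_
        obtain ⟨a, e, s⟩ := ω
        rw [add_sub_assoc]
        refine (abs_add_le _ _).trans (add_le_add (hK _ _ _) ?_)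
        cases a with
        | false => exact ih _ (by simp only [nextState]; omega) _ _ _ hb'
        | true =>
          refine (hL _ _ _ _ (batteryStep_le _ _ _ _) hb').trans ?_
          have : 0 ≤ 2 * K * (j + 1) := by positivity
          linarith
      rw [abs_sub_comm] at h1
      have h3 := abs_sub_le (meanReward z p10 q Bmax r (n + 1) c b)
        (meanReward z p10 q Bmax r n 0 b') (meanReward z p10 q Bmax r (n + 1) 0 b')
      push_cast
      linarith

end MeanReward

/-! ### Renewal cycles -/

/-- One slot with input `a`, acting on functions of the battery level. -/
def energyOp (p10 q : ℝ) (Bmax : ℕ) (a : Bool) : Module.End ℝ (ℕ → ℝ) where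
  toFun h b := ∑ ω : Bool × Bool, chan p10 a ω.1 * useProb q ω.2 * h (batteryStep Bmax b ω.1 ω.2)
  map_add' f g := by
    ext b
    simp only [Pi.add_apply, mul_add, Finset.sum_add_distrib]
  map_smul' t f := by
    ext b
    simp only [Pi.smul_apply, smul_eq_mul, RingHom.id_apply, Finset.mul_sum]
    exact Finset.sum_congr rfl fun _ _ => by ring

theorem energyOp_apply (p10 q : ℝ) (Bmax : ℕ) (a : Bool) (h : ℕ → ℝ) (b : ℕ) :
    energyOp p10 q Bmax a h b =
      ∑ ω : Bool × Bool, chan p10 a ω.1 * useProb q ω.2 * h (batteryStep Bmax b ω.1 ω.2) := rfl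

/-- Probability that a renewal interval is longer than `c`. -/
def survival (z : ℕ → ℝ) (c : ℕ) : ℝ := ∏ l ∈ Finset.range c, z l

/-- Mean of a function of the battery level. -/
def batteryMean {Bmax : ℕ} (πB : Fin (Bmax + 1) → ℝ) : (ℕ → ℝ) →ₗ[ℝ] ℝ where
  toFun f := ∑ b : Fin (Bmax + 1), πB b * f b
  map_add' f g := by simp only [Pi.add_apply, mul_add, Finset.sum_add_distrib]
  map_smul' t f := by
    simp only [Pi.smul_apply, smul_eq_mul, RingHom.id_apply, Finset.mul_sum]
    exact Finset.sum_congr rfl fun _ _ => by ring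

theorem batteryMean_apply {Bmax : ℕ} (πB : Fin (Bmax + 1) → ℝ) (f : ℕ → ℝ) :
    batteryMean πB f = ∑ b : Fin (Bmax + 1), πB b * f b := rfl

/-- Expected sum over the slots of a renewal interval of a function of code state and battery. -/
def cycleSum (z : ℕ → ℝ) (p10 q : ℝ) (k : ℕ) {Bmax : ℕ} (πB : Fin (Bmax + 1) → ℝ)
    (H : ℕ → ℕ → ℝ) : ℝ :=
  ∑ c ∈ Finset.range (k + 1),
    survival z c * batteryMean πB ((energyOp p10 q Bmax false ^ c) (H c))

/-- Mean length of a renewal interval. -/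
def cycleLength (z : ℕ → ℝ) (k : ℕ) : ℝ := ∑ c ∈ Finset.range (k + 1), survival z c

section Cycle

variable {z : ℕ → ℝ} {p10 q : ℝ} {k Bmax : ℕ} {πB : Fin (Bmax + 1) → ℝ}
  {r : ℕ → ℕ → Bool × Bool × Bool → ℝ}

theorem survival_succ (z : ℕ → ℝ) (c : ℕ) : survival z (c + 1) = survival z c * z c :=
  Finset.prod_range_succ _ _

theorem survival_nonneg (hz : ∀ c, z c ∈ Set.Icc (0 : ℝ) 1) (c : ℕ) : 0 ≤ survival z c :=
  Finset.prod_nonneg fun l _ => (hz l).1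

theorem survival_eq_zero (hzk : ∀ c, k ≤ c → z c = 0) : survival z (k + 1) = 0 := by
  rw [survival_succ, hzk k le_rfl, mul_zero]

theorem cycleLength_pos (hz : ∀ c, z c ∈ Set.Icc (0 : ℝ) 1) : 0 < cycleLength z k := by
  rw [cycleLength, Finset.sum_range_succ']
  have h1 : survival z 0 = 1 := by simp [survival]
  have h2 := Finset.sum_nonneg fun c (_ : c ∈ Finset.range k) => survival_nonneg hz (c + 1)
  linarith

theorem energyOp_const (p10 q : ℝ) (Bmax : ℕ) (a : Bool) (t : ℝ) :
    energyOp p10 q Bmax a (fun _ => t) = fun _ => t := by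
  ext b
  rw [energyOp_apply, ← Finset.sum_mul, sum_chan_mul_useProb, one_mul]

theorem energyOp_pow_const (p10 q : ℝ) (Bmax : ℕ) (a : Bool) (t : ℝ) (c : ℕ) :
    (energyOp p10 q Bmax a ^ c) (fun _ => t) = fun _ => t := by
  induction c with
  | zero => rfl
  | succ c ih => rw [pow_succ', Module.End.mul_apply, ih, energyOp_const]

theorem energyOp_pow_mono (hp : p10 ∈ Set.Icc (0 : ℝ) 1) (hq : q ∈ Set.Icc (0 : ℝ) 1) (a : Bool)
    {f g : ℕ → ℝ} (h : ∀ b ≤ Bmax, f b ≤ g b) (c : ℕ) :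
    ∀ b ≤ Bmax, (energyOp p10 q Bmax a ^ c) f b ≤ (energyOp p10 q Bmax a ^ c) g b := by
  induction c with
  | zero => exact h
  | succ c ih =>
    intro b _
    rw [pow_succ', Module.End.mul_apply, Module.End.mul_apply, energyOp_apply, energyOp_apply]
    exact Finset.sum_le_sum fun ω _ => mul_le_mul_of_nonneg_left (ih _ (batteryStep_le _ _ _ _))
      (mul_nonneg (chan_nonneg hp _ _) (useProb_nonneg hq _))

theorem cycleSum_const (hπ : πB ∈ stdSimplex ℝ (Fin (Bmax + 1))) (t : ℝ) :
    cycleSum z p10 q k πB (fun _ _ => t) = t * cycleLength z k := by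
  simp only [cycleSum, energyOp_pow_const, batteryMean_apply, ← Finset.sum_mul, hπ.2, one_mul,
    cycleLength]
  rw [mul_comm]

theorem cycleSum_add (H G : ℕ → ℕ → ℝ) :
    cycleSum z p10 q k πB (fun c b => H c b + G c b) =
      cycleSum z p10 q k πB H + cycleSum z p10 q k πB G := by
  simp only [cycleSum, ← Finset.sum_add_distrib, ← mul_add, ← map_add]
  rfl

theorem cycleSum_mono (hz : ∀ c, z c ∈ Set.Icc (0 : ℝ) 1) (hp : p10 ∈ Set.Icc (0 : ℝ) 1)
    (hq : q ∈ Set.Icc (0 : ℝ) 1) (hπ : πB ∈ stdSimplex ℝ (Fin (Bmax + 1)))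
    {H G : ℕ → ℕ → ℝ} (h : ∀ c, ∀ b ≤ Bmax, H c b ≤ G c b) :
    cycleSum z p10 q k πB H ≤ cycleSum z p10 q k πB G := by
  refine Finset.sum_le_sum fun c _ => mul_le_mul_of_nonneg_left ?_ (survival_nonneg hz c)
  rw [batteryMean_apply, batteryMean_apply]
  exact Finset.sum_le_sum fun b _ => mul_le_mul_of_nonneg_left
    (energyOp_pow_mono hp hq false (h c) c b (Nat.lt_succ_iff.1 b.2)) (hπ.1 b)

/-- Stationarity of the battery law at the renewals, tested against functions. -/
def RenewalInvariant (z : ℕ → ℝ) (p10 q : ℝ) (k : ℕ) {Bmax : ℕ} (πB : Fin (Bmax + 1) → ℝ) : Prop :=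
  ∀ h : ℕ → ℝ, ∑ c ∈ Finset.range (k + 1), survival z c * (1 - z c) *
    batteryMean πB ((energyOp p10 q Bmax false ^ c) (energyOp p10 q Bmax true h)) =
      batteryMean πB h

/-- One transition shifts the cycle by one slot. The 0-branch from `c` is the term `c + 1`, and the
1-branches together restart the cycle, giving by stationarity the term `c = 0`. No mass is left
beyond state `k`. -/
theorem cycleSum_next (hzk : ∀ c, k ≤ c → z c = 0) (hst : RenewalInvariant z p10 q k πB)
    (H : ℕ → ℕ → ℝ) :
    cycleSum z p10 q k πB (fun c b => ∑ ω, slotProb z p10 q c ω *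
      H (nextState c ω.1) (batteryStep Bmax b ω.2.1 ω.2.2)) = cycleSum z p10 q k πB H := by
  have h1 : ∀ c, (fun b => ∑ ω, slotProb z p10 q c ω *
      H (nextState c ω.1) (batteryStep Bmax b ω.2.1 ω.2.2)) =
      z c • energyOp p10 q Bmax false (H (c + 1)) +
        (1 - z c) • energyOp p10 q Bmax true (H 0) := by
    intro c
    ext b
    rw [Fintype.sum_prod_type, Fintype.sum_bool]
    simp only [slotProb, symProb, nextState, Pi.add_apply, Pi.smul_apply, smul_eq_mul,
      energyOp_apply, Finset.mul_sum, mul_assoc]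
    rw [add_comm]
  unfold cycleSum
  simp only [h1, map_add, map_smul, smul_eq_mul, mul_add, Finset.sum_add_distrib]
  have h2 := hst (H 0)
  simp only [mul_assoc] at h2
  rw [h2]
  have h3 : ∀ c, survival z c * (z c * batteryMean πB
      ((energyOp p10 q Bmax false ^ c) (energyOp p10 q Bmax false (H (c + 1))))) =
      survival z (c + 1) * batteryMean πB ((energyOp p10 q Bmax false ^ (c + 1)) (H (c + 1))) := by
    intro c
    rw [survival_succ, pow_succ, Module.End.mul_apply, mul_assoc]
  simp only [h3]
  -- The sum up to `k + 1` is split at both ends: the top term vanishes and the bottom one is the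
  -- restart term.
  have h4 := Finset.sum_range_succ' (fun c => survival z c * batteryMean πB
    ((energyOp p10 q Bmax false ^ c) (H c))) (k + 1)
  rw [Finset.sum_range_succ, survival_eq_zero hzk] at h4
  simpa [survival] using h4.symm

/-- Expected reward of a slot. -/
def slotReward (z : ℕ → ℝ) (p10 q : ℝ) (r : ℕ → ℕ → Bool × Bool × Bool → ℝ) (c b : ℕ) : ℝ :=
  ∑ ω, slotProb z p10 q c ω * r c b ω

theorem cycleSum_meanReward (hzk : ∀ c, k ≤ c → z c = 0) (hst : RenewalInvariant z p10 q k πB)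
    (hπ : πB ∈ stdSimplex ℝ (Fin (Bmax + 1))) (n : ℕ) :
    cycleSum z p10 q k πB (meanReward z p10 q Bmax r n) =
      n * cycleSum z p10 q k πB (slotReward z p10 q r) := by
  induction n with
  | zero =>
    have : meanReward z p10 q Bmax r 0 = fun _ _ => 0 := by
      ext c b; exact meanReward_zero c b
    rw [this, cycleSum_const hπ]; simp
  | succ n ih =>
    have : meanReward z p10 q Bmax r (n + 1) = fun c b => slotReward z p10 q r c b +
        ∑ ω, slotProb z p10 q c ω * meanReward z p10 q Bmax r n (nextState c ω.1)
          (batteryStep Bmax b ω.2.1 ω.2.2) := by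
      ext c b
      rw [meanReward_succ]
      simp only [mul_add, Finset.sum_add_distrib, slotReward]
    rw [this, cycleSum_add, cycleSum_next hzk hst, ih]
    push_cast
    ring

/-- The mean reward grows linearly, with uniformly bounded error. -/
theorem abs_meanReward_sub_linear_le {K L : ℝ} (hz : ∀ c, z c ∈ Set.Icc (0 : ℝ) 1)
    (hzk : ∀ c, k ≤ c → z c = 0)
    (hp : p10 ∈ Set.Icc (0 : ℝ) 1) (hq : q ∈ Set.Icc (0 : ℝ) 1)
    (hst : RenewalInvariant z p10 q k πB) (hπ : πB ∈ stdSimplex ℝ (Fin (Bmax + 1)))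
    (hK : ∀ c b ω, |r c b ω| ≤ K)
    (hL : ∀ n c b b', b ≤ Bmax → b' ≤ Bmax →
      |meanReward z p10 q Bmax r n c b - meanReward z p10 q Bmax r n c b'| ≤ L)
    (n c b : ℕ) :
    |meanReward z p10 q Bmax r n c b -
      n * (cycleSum z p10 q k πB (slotReward z p10 q r) / cycleLength z k)| ≤
        2 * (2 * K * (k + 1) + L) := by
  have h0 := abs_meanReward_sub_renewal_le hz hzk hp hq hK hL k
  -- Both states are compared with `(0, 0)`, whence the factor 2; `j = k` serves every initial code
  -- state.
  have h1 : ∀ c b c' b', |meanReward z p10 q Bmax r n c b - meanReward z p10 q Bmax r n c' b'| ≤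
      2 * (2 * K * (k + 1) + L) := by
    intro c b c' b'
    have ha := h0 c (Nat.le_add_left _ _) n b 0 (Nat.zero_le _)
    have hb := h0 c' (Nat.le_add_left _ _) n b' 0 (Nat.zero_le _)
    rw [abs_sub_comm] at hb
    have hc := abs_sub_le (meanReward z p10 q Bmax r n c b) (meanReward z p10 q Bmax r n 0 0)
      (meanReward z p10 q Bmax r n c' b')
    linarith
  have hE : 0 < cycleLength z k := cycleLength_pos hz
  have h2 := cycleSum_meanReward (r := r) hzk hst hπ n
  have h3 : n * (cycleSum z p10 q k πB (slotReward z p10 q r) / cycleLength z k) =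
      cycleSum z p10 q k πB (meanReward z p10 q Bmax r n) / cycleLength z k := by
    rw [h2, mul_div_assoc]
  set D := 2 * (2 * K * (k + 1) + L) with hD
  set V := meanReward z p10 q Bmax r n c b
  set W := cycleSum z p10 q k πB (meanReward z p10 q Bmax r n)
  -- Pointwise bounds on the `n`-slot mean are integrated over the occupation measure, whose total
  -- mass is `cycleLength z k`.
  have h4 : (V - D) * cycleLength z k ≤ W := by
    rw [← cycleSum_const (p10 := p10) (q := q) hπ]
    refine cycleSum_mono hz hp hq hπ fun c' b' _ => ?_
    have := (abs_sub_le_iff.1 (h1 c b c' b')).1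
    linarith
  have h5 : W ≤ (V + D) * cycleLength z k := by
    rw [← cycleSum_const (p10 := p10) (q := q) hπ]
    refine cycleSum_mono hz hp hq hπ fun c' b' _ => ?_
    have := (abs_sub_le_iff.1 (h1 c b c' b')).2
    linarith
  rw [h3, abs_sub_le_iff]
  have h6 := (le_div_iff₀ hE).2 h4
  have h7 := (div_le_iff₀ hE).2 h5
  constructor <;> linarith

end Cycle

/-- If the mean reward is linear up to a bounded error, then its variance grows at most
linearly. -/
theorem blockMean_sq_rewardSum_sub_le {z : ℕ → ℝ} {p10 q : ℝ} {Bmax : ℕ}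
    {r : ℕ → ℕ → Bool × Bool × Bool → ℝ} {K C g : ℝ} (hz : ∀ c, z c ∈ Set.Icc (0 : ℝ) 1)
    (hp : p10 ∈ Set.Icc (0 : ℝ) 1) (hq : q ∈ Set.Icc (0 : ℝ) 1)
    (hK : ∀ c b ω, |r c b ω| ≤ K)
    (hC : ∀ n c b, |meanReward z p10 q Bmax r n c b - n * g| ≤ C) (n c b : ℕ) :
    blockMean z p10 q c (fun x y u : Word n => (rewardSum Bmax r c b x y u - n * g) ^ 2) ≤
      n * ((K + |g|) ^ 2 + 2 * (K + |g|) * C) := by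
  have hK0 : 0 ≤ K := (abs_nonneg _).trans (hK 0 0 (true, true, true))
  have hC0 : 0 ≤ C := (abs_nonneg _).trans (hC 0 0 0)
  induction n generalizing c b with
  | zero => simp [blockMean_zero, rewardSum]
  | succ n ih =>
    rw [blockMean_succ]
    have h1 : ∀ ω : Bool × Bool × Bool,
        (blockMean z p10 q (nextState c ω.1) fun x y u : Word n =>
          (rewardSum Bmax r c b (Fin.cons ω.1 x : Word (n + 1)) (Fin.cons ω.2.1 y : Word (n + 1))
            (Fin.cons ω.2.2 u : Word (n + 1)) - ((n + 1 : ℕ) : ℝ) * g) ^ 2) ≤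
          (n + 1 : ℕ) * ((K + |g|) ^ 2 + 2 * (K + |g|) * C) := by
      rintro ⟨a, e, s⟩
      set c' := nextState c a
      set b' := batteryStep Bmax b e s
      have h2 : (fun x y u : Word n =>
          (rewardSum Bmax r c b (Fin.cons a x : Word (n + 1)) (Fin.cons e y : Word (n + 1))
            (Fin.cons s u : Word (n + 1)) - ((n + 1 : ℕ) : ℝ) * g) ^ 2) =
          fun x y u => ((r c b (a, e, s) - g) ^ 2 - 2 * (r c b (a, e, s) - g) * (n * g)) +
            (2 * (r c b (a, e, s) - g) * rewardSum Bmax r c' b' x y u +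
              (rewardSum Bmax r c' b' x y u - n * g) ^ 2) := by
        ext x y u
        rw [rewardSum_cons]
        push_cast
        ring
      rw [h2, blockMean_add, blockMean_add, blockMean_const, blockMean_const_mul]
      have h3 := ih c' b'
      have h4 := hC n c' b'
      unfold meanReward at h4
      set V := blockMean z p10 q c' (rewardSum Bmax r c' b' : Word n → Word n → Word n → ℝ)
      have h5 : |r c b (a, e, s) - g| ≤ K + |g| :=
        (abs_sub _ _).trans (add_le_add (hK _ _ _) le_rfl)
      have h6 : (r c b (a, e, s) - g) ^ 2 ≤ (K + |g|) ^ 2 := sq_le_sq' (abs_le.1 h5).1 (abs_le.1 h5).2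
      -- The cross term would be of order `n` in general; the bounded error of the mean makes it
      -- bounded, so each slot adds only a constant to the second moment.
      have h7 : (r c b (a, e, s) - g) * (V - n * g) ≤ (K + |g|) * C :=
        (le_abs_self _).trans (by
          rw [abs_mul]
          exact mul_le_mul h5 h4 (abs_nonneg _) (by positivity))
      push_cast
      linarith
    calc _ ≤ ∑ ω, slotProb z p10 q c ω * ((n + 1 : ℕ) * ((K + |g|) ^ 2 + 2 * (K + |g|) * C)) :=
          Finset.sum_le_sum fun ω _ =>
            mul_le_mul_of_nonneg_left (h1 ω) (slotProb_nonneg hz hp hq c ω)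
      _ = _ := by rw [← Finset.sum_mul, sum_slotProb, one_mul]

/-! ### The number of overflows and underflows depends little on the initial battery level -/

/-- Coupling: both batteries see the same symbols, outputs and usages, and the gap between their
levels pays for every difference in reward. -/
theorem abs_meanReward_sub_le_of_step {z : ℕ → ℝ} {p10 q : ℝ} {Bmax : ℕ}
    {r : ℕ → ℕ → Bool × Bool × Bool → ℝ} (hz : ∀ c, z c ∈ Set.Icc (0 : ℝ) 1)
    (hp : p10 ∈ Set.Icc (0 : ℝ) 1) (hq : q ∈ Set.Icc (0 : ℝ) 1)
    (hr : ∀ c b b' a e s, b ≤ Bmax → b' ≤ Bmax → |r c b (a, e, s) - r c b' (a, e, s)| +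
      |(batteryStep Bmax b e s : ℝ) - batteryStep Bmax b' e s| ≤ |(b : ℝ) - b'|)
    (n c b b' : ℕ) (hb : b ≤ Bmax) (hb' : b' ≤ Bmax) :
    |meanReward z p10 q Bmax r n c b - meanReward z p10 q Bmax r n c b'| ≤ |(b : ℝ) - b'| := by
  induction n generalizing c b b' with
  | zero => simp [meanReward_zero]
  | succ n ih =>
    rw [meanReward_succ, meanReward_succ, ← Finset.sum_sub_distrib, ← sub_zero (∑ ω, _)]
    simp only [← mul_sub]
    refine abs_sum_slotProb_mul_sub_le hz hp hq c fun ω _ => ?_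
    obtain ⟨a, e, s⟩ := ω
    rw [sub_zero, add_sub_add_comm]
    refine (abs_add_le _ _).trans (le_trans ?_ (hr c b b' a e s hb hb'))
    exact add_le_add le_rfl (ih _ _ _ (batteryStep_le _ _ _ _) (batteryStep_le _ _ _ _))

/-- An overflow at the fuller battery alone coincides with the other battery gaining a unit, so the
gap shrinks by exactly the reward difference. In all other cases the gap does not grow. -/
theorem abs_overflowReward_sub_add_le (Bmax b b' : ℕ) (e s : Bool) (hb : b ≤ Bmax)
    (hb' : b' ≤ Bmax) :
    |overflowReward Bmax b e s - overflowReward Bmax b' e s| +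
      |(batteryStep Bmax b e s : ℝ) - batteryStep Bmax b' e s| ≤ |(b : ℝ) - b'| := by
  wlog h : b ≤ b' generalizing b b'
  · have := this b' b hb' hb (le_of_not_ge h)
    rwa [abs_sub_comm, abs_sub_comm (batteryStep Bmax b e s : ℝ), abs_sub_comm (b : ℝ)]
  have h1 : overflowReward Bmax b e s = ((if b = Bmax ∧ e = true ∧ s = false then 1 else 0 : ℕ) : ℝ) := by
    simp [overflowReward]
  have h2 : overflowReward Bmax b' e s = ((if b' = Bmax ∧ e = true ∧ s = false then 1 else 0 : ℕ) : ℝ) := by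
    simp [overflowReward]
  -- With `b ≤ b'` all signs are known, so the claim becomes linear inequalities between natural
  -- numbers, settled by cases on the output and the usage.
  have h3 : (if b = Bmax ∧ e = true ∧ s = false then 1 else 0 : ℕ) ≤
      (if b' = Bmax ∧ e = true ∧ s = false then 1 else 0 : ℕ) ∧
      batteryStep Bmax b e s ≤ batteryStep Bmax b' e s ∧
      (if b' = Bmax ∧ e = true ∧ s = false then 1 else 0 : ℕ) + batteryStep Bmax b' e s + b ≤
      (if b = Bmax ∧ e = true ∧ s = false then 1 else 0 : ℕ) + batteryStep Bmax b e s + b' := by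
    unfold batteryStep
    cases e <;> cases s <;> simp <;> (try split_ifs) <;> omega
  obtain ⟨ha, hc, hd⟩ := h3
  rw [h1, h2]
  have ha' := (Nat.cast_le (α := ℝ)).2 ha
  have hc' := (Nat.cast_le (α := ℝ)).2 hc
  have hd' := (Nat.cast_le (α := ℝ)).2 hd
  have hh := (Nat.cast_le (α := ℝ)).2 h
  rw [abs_of_nonpos (by linarith), abs_of_nonpos (by linarith), abs_of_nonpos (by linarith)]
  rw [Nat.cast_add, Nat.cast_add, Nat.cast_add, Nat.cast_add] at hd'
  linarith

/-- The mirror image: only the emptier battery can underflow alone, and the other one then loses a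
unit. -/
theorem abs_underflowReward_sub_add_le (Bmax b b' : ℕ) (e s : Bool) (hb : b ≤ Bmax)
    (hb' : b' ≤ Bmax) :
    |underflowReward b e s - underflowReward b' e s| +
      |(batteryStep Bmax b e s : ℝ) - batteryStep Bmax b' e s| ≤ |(b : ℝ) - b'| := by
  wlog h : b ≤ b' generalizing b b'
  · have := this b' b hb' hb (le_of_not_ge h)
    rwa [abs_sub_comm, abs_sub_comm (batteryStep Bmax b e s : ℝ), abs_sub_comm (b : ℝ)]
  have h1 : underflowReward b e s = ((if b = 0 ∧ e = false ∧ s = true then 1 else 0 : ℕ) : ℝ) := by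
    simp [underflowReward]
  have h2 : underflowReward b' e s = ((if b' = 0 ∧ e = false ∧ s = true then 1 else 0 : ℕ) : ℝ) := by
    simp [underflowReward]
  have h3 : (if b' = 0 ∧ e = false ∧ s = true then 1 else 0 : ℕ) ≤
      (if b = 0 ∧ e = false ∧ s = true then 1 else 0 : ℕ) ∧
      batteryStep Bmax b e s ≤ batteryStep Bmax b' e s ∧
      (if b = 0 ∧ e = false ∧ s = true then 1 else 0 : ℕ) + batteryStep Bmax b' e s + b ≤
      (if b' = 0 ∧ e = false ∧ s = true then 1 else 0 : ℕ) + batteryStep Bmax b e s + b' := by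
    unfold batteryStep
    cases e <;> cases s <;> simp <;> (try split_ifs) <;> omega
  obtain ⟨ha, hc, hd⟩ := h3
  rw [h1, h2]
  have ha' := (Nat.cast_le (α := ℝ)).2 ha
  have hc' := (Nat.cast_le (α := ℝ)).2 hc
  have hd' := (Nat.cast_le (α := ℝ)).2 hd
  have hh := (Nat.cast_le (α := ℝ)).2 h
  rw [abs_of_nonneg (by linarith), abs_of_nonpos (by linarith), abs_of_nonpos (by linarith)]
  rw [Nat.cast_add, Nat.cast_add, Nat.cast_add, Nat.cast_add] at hd'
  linarith

/-! ### Stationary distributions -/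

/-- Every stochastic matrix has a stationary distribution. -/
theorem exists_isStationaryDist {ι : Type*} [Fintype ι] [DecidableEq ι] [Nonempty ι]
    (T : Matrix ι ι ℝ) (h0 : ∀ i j, 0 ≤ T i j) (h1 : ∀ i, ∑ j, T i j = 1) :
    ∃ π, IsStationaryDist T π := by
  -- The constant vector is a right eigenvector for the eigenvalue 1, so a left eigenvector `v`
  -- exists as well.
  have hdet : (T - 1).det = 0 := by
    refine Matrix.exists_mulVec_eq_zero_iff.1 ⟨fun _ => 1, ?_, ?_⟩
    · exact fun h => one_ne_zero (congrFun h (Classical.arbitrary ι))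
    · ext i
      simp [Matrix.mulVec, dotProduct, h1, Matrix.one_apply]
  obtain ⟨v, hv, hvT⟩ := Matrix.exists_vecMul_eq_zero_iff.2 hdet
  have hfix : ∀ j, ∑ i, v i * T i j = v j := by
    intro j
    have := congrFun hvT j
    rw [Matrix.vecMul_sub, Matrix.vecMul_one, Pi.sub_apply, Pi.zero_apply, sub_eq_zero] at this
    exact this
  have hle : ∀ j, |v j| ≤ ∑ i, |v i| * T i j := by
    intro j
    refine (congrArg abs (hfix j)).ge.trans ?_
    refine (Finset.abs_sum_le_sum_abs _ _).trans (Finset.sum_le_sum fun i _ => ?_)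
    rw [abs_mul, abs_of_nonneg (h0 i j)]
  have hsum : ∑ j, |v j| = ∑ j, ∑ i, |v i| * T i j := by
    rw [Finset.sum_comm]
    simp only [← Finset.mul_sum, h1, mul_one]
  -- Since `|v| ≤ |v| T` coordinatewise and both sides have equal total, `|v|` itself is invariant;
  -- this avoids any irreducibility assumption.
  have heq := (Finset.sum_eq_sum_iff_of_le fun j _ => hle j).1 hsum
  have hpos : 0 < ∑ j, |v j| := by
    obtain ⟨i, hi⟩ := Function.ne_iff.1 hv
    exact Finset.sum_pos' (fun _ _ => abs_nonneg _) ⟨i, Finset.mem_univ _, abs_pos.2 hi⟩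
  refine ⟨fun j => |v j| / ∑ j, |v j|, ⟨fun j => by positivity, ?_⟩, ?_⟩
  · rw [← Finset.sum_div, div_self hpos.ne']
  · ext j
    rw [heq j (Finset.mem_univ _), Finset.sum_div]
    exact Finset.sum_congr rfl fun i _ => by ring

/-- State `c + 1` is entered only from `c`, so the balance equations fix `π` up to the value at 0,
and normalisation fixes that value. -/
theorem isStationaryDist_codeTrans_iff {d k : ℕ} {p : ℕ → ℝ}
    (hp : ∀ j, d ≤ j → j < k → p j ∈ Set.Ioo (0 : ℝ) 1) (π : Fin (k + 1) → ℝ) :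
    IsStationaryDist (codeTrans d k p) π ↔
      ∀ c, π c = survival (zeroProb d k p) c / cycleLength (zeroProb d k p) k := by
  set z := zeroProb d k p with hzdef
  have hz : ∀ c, z c ∈ Set.Icc (0 : ℝ) 1 := zeroProb_mem hp
  have hzk : ∀ c, k ≤ c → z c = 0 := fun c h => zeroProb_of_le p h
  have hE : 0 < cycleLength z k := cycleLength_pos hz
  have hsucc : ∀ c (h : c < k), Matrix.vecMul π (codeTrans d k p) ⟨c + 1, Nat.succ_lt_succ h⟩ =
      π ⟨c, h.trans (Nat.lt_succ_self k)⟩ * z c := by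
    intro c h
    simp only [Matrix.vecMul, dotProduct, codeTrans]
    rw [Finset.sum_eq_single ⟨c, h.trans (Nat.lt_succ_self k)⟩]
    · simp [hzdef]
    · intro i _ hi
      have : c ≠ (i : ℕ) := fun h => hi (Fin.ext h.symm)
      simp [this]
    · simp
  have hsum : ∑ c : Fin (k + 1), survival z c = cycleLength z k :=
    Fin.sum_univ_eq_sum_range (survival z) (k + 1)
  constructor
  · rintro ⟨hπ, hst⟩
    have h1 : ∀ c (h : c < k + 1), π ⟨c, h⟩ = π 0 * survival z c := by
      intro c
      induction c with
      | zero => intro h; simp [survival]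
      | succ c ih =>
        intro h
        rw [← congrFun hst, hsucc c (Nat.lt_of_succ_lt_succ h), ih, survival_succ, mul_assoc]
    have h2 := hπ.2
    rw [Finset.sum_congr rfl fun (c : Fin (k + 1)) _ => h1 c c.2, ← Finset.mul_sum, hsum] at h2
    intro c
    rw [h1 c c.2, eq_div_iff hE.ne', mul_right_comm, h2, one_mul]
  · intro h
    have h1 : ∑ c, π c = 1 := by
      rw [Finset.sum_congr rfl fun c _ => h c, ← Finset.sum_div, hsum, div_self hE.ne']
    refine ⟨⟨fun c => ?_, h1⟩, ?_⟩
    · rw [h]; exact div_nonneg (survival_nonneg hz _) hE.le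
    · have h3 : ∀ c (hc : c < k), Matrix.vecMul π (codeTrans d k p) ⟨c + 1, Nat.succ_lt_succ hc⟩ =
          π ⟨c + 1, Nat.succ_lt_succ hc⟩ := by
        intro c hc
        rw [hsucc c hc, h, h, survival_succ]
        ring
      ext ⟨c, hc⟩
      cases c with
      | succ c => exact h3 c (Nat.lt_of_succ_lt_succ hc)
      | zero =>
        -- The balance at state 0 follows from the others, because the transitions preserve total
        -- mass.
        have h4 : ∑ j, Matrix.vecMul π (codeTrans d k p) j = ∑ j, π j := by
          simp only [Matrix.vecMul, dotProduct]
          rw [Finset.sum_comm]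
          refine Finset.sum_congr rfl fun i _ => ?_
          rw [← Finset.mul_sum, Fin.sum_univ_succ]
          have h5 : ∑ j : Fin k, codeTrans d k p i j.succ = z i := by
            by_cases hi : (i : ℕ) < k
            · rw [Finset.sum_eq_single ⟨i, hi⟩]
              · simp [codeTrans, hzdef]
              · intro j _ hj
                have : (j : ℕ) ≠ i := fun h => hj (Fin.ext h)
                simp [codeTrans, this]
              · simp
            · rw [hzk i (not_lt.1 hi)]
              refine Finset.sum_eq_zero fun j _ => ?_
              have : (j : ℕ) ≠ i := by omega
              simp [codeTrans, this]
          rw [h5]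
          simp [codeTrans, hzdef]
        have h5 : ∑ j : Fin k, Matrix.vecMul π (codeTrans d k p) j.succ = ∑ j : Fin k, π j.succ :=
          Finset.sum_congr rfl fun j _ => h3 j j.2
        rw [Fin.sum_univ_succ, Fin.sum_univ_succ, h5] at h4
        exact add_right_cancel h4

/-! ### The law of a renewal interval -/

theorem survival_zeroProb {d k : ℕ} (p : ℕ → ℝ) {c : ℕ} (hc : c ≤ k) :
    survival (zeroProb d k p) c = ∏ l ∈ Finset.Ico d c, p l := by
  induction c with
  | zero => simp [survival]
  | succ c ih =>
    rw [survival_succ, ih (Nat.le_of_succ_le hc)]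
    by_cases h : c < d
    · rw [Finset.Ico_eq_empty (by omega), Finset.Ico_eq_empty (by omega)]
      simp [zeroProb, h, Nat.lt_of_succ_le hc]
    · rw [Finset.prod_Ico_succ_top (not_lt.1 h)]
      simp [zeroProb, h, Nat.lt_of_succ_le hc]

theorem intervalProb_succ {d k : ℕ} (hdk : d ≤ k) (p : ℕ → ℝ) {c : ℕ} (hc : c ≤ k) :
    intervalProb d k p (c + 1) =
      survival (zeroProb d k p) c * (1 - zeroProb d k p c) := by
  rw [survival_zeroProb p hc]
  by_cases h : c < d
  · have : c < k := h.trans_le hdk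
    simp [intervalProb, zeroProb, h, this, Nat.succ_le_of_lt h]
  · rcases hc.eq_or_lt with rfl | hck
    · simp [intervalProb, zeroProb, h]
    · simp [intervalProb, zeroProb, h, hck, hck.ne]
      rw [if_neg (by omega), mul_comm]

theorem sum_intervalProb_mul {d k : ℕ} (hdk : d ≤ k) (p : ℕ → ℝ) (f : ℕ → ℝ) :
    ∑ i ∈ Finset.Icc (d + 1) (k + 1), intervalProb d k p i * f i =
      ∑ c ∈ Finset.range (k + 1),
        survival (zeroProb d k p) c * (1 - zeroProb d k p c) * f (c + 1) := by
  have h1 : ∑ i ∈ Finset.Icc (d + 1) (k + 1), intervalProb d k p i * f i =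
      ∑ i ∈ Finset.Ico 1 (k + 2), intervalProb d k p i * f i := by
    refine Finset.sum_subset (fun i hi => ?_) fun i _ hi => ?_
    · simp only [Finset.mem_Icc, Finset.mem_Ico] at hi ⊢; omega
    · have : i ≤ d ∨ k + 1 < i := by
        simp only [Finset.mem_Icc] at hi; omega
      simp [intervalProb, this]
  rw [h1, Finset.sum_Ico_eq_sum_range]
  refine Finset.sum_congr rfl fun c hc => ?_
  rw [add_comm 1 c, intervalProb_succ hdk p (Nat.lt_succ_iff.1 (Finset.mem_range.1 hc))]

/-- Summation by parts over a renewal interval. -/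
theorem sum_survival_mul_sum {M : Type*} [AddCommGroup M] [Module ℝ M] {z : ℕ → ℝ} {k : ℕ}
    (hzk : ∀ c, k ≤ c → z c = 0) (a : ℕ → M) :
    ∑ c ∈ Finset.range (k + 1), (survival z c * (1 - z c)) • ∑ j ∈ Finset.range c, a j =
      ∑ c ∈ Finset.range (k + 1), (survival z c * z c) • a c := by
  have h : ∀ n, ∑ c ∈ Finset.range n, (survival z c * (1 - z c)) • ∑ j ∈ Finset.range c, a j +
      survival z n • ∑ j ∈ Finset.range n, a j =
      ∑ c ∈ Finset.range n, (survival z c * z c) • a c := by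
    intro n
    induction n with
    | zero => simp
    | succ n ih =>
      rw [Finset.sum_range_succ (fun c => (survival z c * z c) • a c), ← ih,
        Finset.sum_range_succ, Finset.sum_range_succ a, survival_succ]
      module
  have := h (k + 1)
  rwa [survival_eq_zero hzk, zero_smul, add_zero] at this

theorem sum_survival_mul_one_sub {z : ℕ → ℝ} {k : ℕ} (hzk : ∀ c, k ≤ c → z c = 0) :
    ∑ c ∈ Finset.range (k + 1), survival z c * (1 - z c) = 1 := by
  have h : ∀ c, survival z c * (1 - z c) = survival z c - survival z (c + 1) := by
    intro c; rw [survival_succ]; ring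
  simp only [h]
  rw [Finset.sum_range_sub', survival_eq_zero hzk]
  simp [survival]

/-- The mean of the interval length is the sum of its tail probabilities, obtained by summation by
parts. -/
theorem meanInterval_eq_cycleLength {d k : ℕ} (hdk : d ≤ k) (p : ℕ → ℝ) :
    meanInterval d k p = cycleLength (zeroProb d k p) k := by
  have hzk : ∀ c, k ≤ c → zeroProb d k p c = 0 := fun c h => zeroProb_of_le p h
  have h1 := sum_survival_mul_sum hzk fun _ => (1 : ℝ)
  have h2 := sum_survival_mul_one_sub hzk
  simp only [meanInterval, mul_comm _ (intervalProb d k p _)]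
  rw [sum_intervalProb_mul hdk p fun i => (i : ℝ)]
  simp only [Finset.sum_const, Finset.card_range, smul_eq_mul, nsmul_eq_mul, mul_one] at h1
  push_cast
  simp only [mul_add, mul_one, Finset.sum_add_distrib, h1, cycleLength]
  rw [← Finset.sum_add_distrib]
  exact Finset.sum_congr rfl fun c _ => by ring

/-! ### Rewards and battery level over a renewal interval -/

theorem renewalWord_one : renewalWord 1 = (Fin.cons true Fin.elim0 : Word 1) := by
  ext i
  rw [Subsingleton.elim i 0]
  simp [renewalWord]

theorem renewalWord_succ_succ (m : ℕ) :
    renewalWord (m + 2) = (Fin.cons false (renewalWord (m + 1)) : Word (m + 2)) := by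
  ext i
  refine Fin.cases ?_ (fun j => ?_) i
  · simp [renewalWord]
  · simp [renewalWord]

theorem energyMean_renewalWord_battery (p10 q : ℝ) (Bmax : ℕ) (h : ℕ → ℝ) (m b : ℕ) :
    energyMean p10 q (renewalWord (m + 1)) (fun y u => h (battery Bmax b y u (m + 1))) =
      (energyOp p10 q Bmax false ^ m) (energyOp p10 q Bmax true h) b := by
  induction m generalizing b with
  | zero =>
    rw [renewalWord_one, energyMean_cons]
    simp only [battery_cons _ _ _ _ _ _ 0, energyMean_zero, pow_zero, Module.End.one_apply,
      energyOp_apply, Nat.zero_add]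
    rfl
  | succ m ih =>
    rw [renewalWord_succ_succ, energyMean_cons]
    simp only [battery_cons, ih]
    rw [pow_succ', Module.End.mul_apply, energyOp_apply]

/-- Expected reward of a slot with input `a`. -/
def inputReward (p10 q : ℝ) (e : ℕ → Bool → Bool → ℝ) (a : Bool) (b : ℕ) : ℝ :=
  ∑ ω : Bool × Bool, chan p10 a ω.1 * useProb q ω.2 * e b ω.1 ω.2

/-- Expected reward of a renewal interval of length `m + 1`. -/
def intervalReward (p10 q : ℝ) (Bmax : ℕ) (e : ℕ → Bool → Bool → ℝ) (m : ℕ) : ℕ → ℝ :=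
  ∑ j ∈ Finset.range m, (energyOp p10 q Bmax false ^ j) (inputReward p10 q e false) +
    (energyOp p10 q Bmax false ^ m) (inputReward p10 q e true)

theorem intervalReward_zero (p10 q : ℝ) (Bmax : ℕ) (e : ℕ → Bool → Bool → ℝ) :
    intervalReward p10 q Bmax e 0 = inputReward p10 q e true := by
  simp [intervalReward]

theorem intervalReward_succ (p10 q : ℝ) (Bmax : ℕ) (e : ℕ → Bool → Bool → ℝ) (m : ℕ) :
    intervalReward p10 q Bmax e (m + 1) = inputReward p10 q e false +
      energyOp p10 q Bmax false (intervalReward p10 q Bmax e m) := by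
  rw [intervalReward, intervalReward, Finset.sum_range_succ', map_add, map_sum]
  simp only [pow_succ', Module.End.mul_apply, pow_zero, Module.End.one_apply]
  abel

theorem energyMean_cons_rewardSum (p10 q : ℝ) (Bmax : ℕ) (e : ℕ → Bool → Bool → ℝ) {n : ℕ}
    (c b : ℕ) (a : Bool) (x : Word n) :
    energyMean p10 q (Fin.cons a x : Word (n + 1))
      (rewardSum Bmax (fun _ b ω => e b ω.2.1 ω.2.2) c b (Fin.cons a x : Word (n + 1))) =
      inputReward p10 q e a b + ∑ ω : Bool × Bool, chan p10 a ω.1 * useProb q ω.2 *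
        energyMean p10 q x (rewardSum Bmax (fun _ b ω => e b ω.2.1 ω.2.2) (nextState c a)
          (batteryStep Bmax b ω.1 ω.2) x) := by
  rw [energyMean_cons]
  simp only [rewardSum_cons, energyMean_add, energyMean_const, mul_add, Finset.sum_add_distrib,
    inputReward]

theorem energyMean_renewalWord_rewardSum (p10 q : ℝ) (Bmax : ℕ) (e : ℕ → Bool → Bool → ℝ)
    (m c b : ℕ) :
    energyMean p10 q (renewalWord (m + 1))
      (rewardSum Bmax (fun _ b ω => e b ω.2.1 ω.2.2) c b (renewalWord (m + 1))) =
      intervalReward p10 q Bmax e m b := by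
  induction m generalizing c b with
  | zero =>
    rw [renewalWord_one, energyMean_cons_rewardSum, intervalReward_zero]
    simp [energyMean_zero, rewardSum]
  | succ m ih =>
    rw [renewalWord_succ_succ, energyMean_cons_rewardSum, intervalReward_succ]
    simp only [ih]
    rfl

theorem meanOverflows_renewalWord (p10 q : ℝ) (Bmax m b : ℕ) :
    meanOverflows p10 q Bmax b (renewalWord (m + 1)) =
      intervalReward p10 q Bmax (overflowReward Bmax) m b := by
  rw [← energyMean_renewalWord_rewardSum p10 q Bmax _ m 0, meanOverflows]
  simp only [overflowCount_eq_rewardSum Bmax 0 b (renewalWord (m + 1))]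

theorem meanUnderflows_renewalWord (p10 q : ℝ) (Bmax m b : ℕ) :
    meanUnderflows p10 q Bmax b (renewalWord (m + 1)) =
      intervalReward p10 q Bmax underflowReward m b := by
  rw [← energyMean_renewalWord_rewardSum p10 q Bmax _ m 0, meanUnderflows]
  simp only [underflowCount_eq_rewardSum Bmax 0 b (renewalWord (m + 1))]

theorem slotReward_eq (z : ℕ → ℝ) (p10 q : ℝ) (e : ℕ → Bool → Bool → ℝ) (c : ℕ) :
    slotReward z p10 q (fun _ b ω => e b ω.2.1 ω.2.2) c =
      z c • inputReward p10 q e false + (1 - z c) • inputReward p10 q e true := by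
  ext b
  rw [slotReward, Fintype.sum_prod_type, Fintype.sum_bool]
  simp only [slotProb, symProb, Pi.add_apply, Pi.smul_apply, smul_eq_mul, inputReward,
    Finset.mul_sum, mul_assoc]
  rw [add_comm]

/-- Summation by parts passes from slots to whole intervals: the slot in state `c` carries a 0
exactly when the interval continues, and otherwise carries the final 1. -/
theorem cycleSum_slotReward {z : ℕ → ℝ} {p10 q : ℝ} {k Bmax : ℕ} {πB : Fin (Bmax + 1) → ℝ}
    (hzk : ∀ c, k ≤ c → z c = 0) (e : ℕ → Bool → Bool → ℝ) :
    cycleSum z p10 q k πB (slotReward z p10 q fun _ b ω => e b ω.2.1 ω.2.2) =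
      batteryMean πB (∑ c ∈ Finset.range (k + 1),
        (survival z c * (1 - z c)) • intervalReward p10 q Bmax e c) := by
  simp only [intervalReward, smul_add, Finset.sum_add_distrib]
  rw [sum_survival_mul_sum hzk, ← Finset.sum_add_distrib, map_sum, cycleSum]
  refine Finset.sum_congr rfl fun c _ => ?_
  rw [slotReward_eq]
  simp only [map_add, map_smul, smul_eq_mul]
  ring

theorem renewalOverflows_eq {d k : ℕ} (hdk : d ≤ k) (p : ℕ → ℝ) (p10 q : ℝ) (Bmax b : ℕ) :
    renewalOverflows d k p p10 q Bmax b = ∑ c ∈ Finset.range (k + 1),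
      survival (zeroProb d k p) c * (1 - zeroProb d k p c) *
        intervalReward p10 q Bmax (overflowReward Bmax) c b := by
  rw [renewalOverflows,
    sum_intervalProb_mul hdk p fun i => meanOverflows p10 q Bmax b (renewalWord i)]
  simp only [meanOverflows_renewalWord]

theorem renewalUnderflows_eq {d k : ℕ} (hdk : d ≤ k) (p : ℕ → ℝ) (p10 q : ℝ) (Bmax b : ℕ) :
    renewalUnderflows d k p p10 q Bmax b = ∑ c ∈ Finset.range (k + 1),
      survival (zeroProb d k p) c * (1 - zeroProb d k p c) *
        intervalReward p10 q Bmax underflowReward c b := by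
  rw [renewalUnderflows,
    sum_intervalProb_mul hdk p fun i => meanUnderflows p10 q Bmax b (renewalWord i)]
  simp only [meanUnderflows_renewalWord]

theorem renewalTrans_eq {d k : ℕ} (hdk : d ≤ k) (p : ℕ → ℝ) (p10 q : ℝ) (Bmax : ℕ)
    (b b' : Fin (Bmax + 1)) :
    renewalTrans d k p p10 q Bmax b b' = ∑ c ∈ Finset.range (k + 1),
      survival (zeroProb d k p) c * (1 - zeroProb d k p c) *
        (energyOp p10 q Bmax false ^ c)
          (energyOp p10 q Bmax true fun x => if x = b' then 1 else 0) b := by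
  rw [renewalTrans, sum_intervalProb_mul hdk p fun i => energyMean p10 q (renewalWord i)
    fun y u => if battery Bmax b y u i = b' then 1 else 0]
  simp only [← energyMean_renewalWord_battery]

/-- After one slot the level lies in `{0,…,Bmax}`, so every test function can be expanded in
indicators of these levels. -/
theorem sum_mul_renewalTrans {d k : ℕ} (hdk : d ≤ k) (p : ℕ → ℝ) (p10 q : ℝ) {Bmax : ℕ}
    (h : ℕ → ℝ) (b : Fin (Bmax + 1)) :
    ∑ b' : Fin (Bmax + 1), h b' * renewalTrans d k p p10 q Bmax b b' = ∑ c ∈ Finset.range (k + 1),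
      survival (zeroProb d k p) c * (1 - zeroProb d k p c) *
        (energyOp p10 q Bmax false ^ c) (energyOp p10 q Bmax true h) b := by
  have h1 : energyOp p10 q Bmax true h = ∑ b' : Fin (Bmax + 1),
      h b' • energyOp p10 q Bmax true (fun x => if x = b' then 1 else 0) := by
    simp only [← map_smul, ← map_sum]
    ext x
    rw [energyOp_apply, energyOp_apply]
    refine Finset.sum_congr rfl fun ω _ => ?_
    congr 1
    set s := batteryStep Bmax x ω.1 ω.2
    have hs : s < Bmax + 1 := Nat.lt_succ_of_le (batteryStep_le _ _ _ _)
    rw [Finset.sum_apply, Finset.sum_eq_single ⟨s, hs⟩]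
    · simp
    · intro b' _ hb'
      have : s ≠ b' := fun h => hb' (Fin.ext h.symm)
      simp [this]
    · simp
  simp only [renewalTrans_eq hdk, Finset.mul_sum]
  rw [Finset.sum_comm]
  refine Finset.sum_congr rfl fun c _ => ?_
  rw [h1, map_sum, Finset.sum_apply, Finset.mul_sum]
  refine Finset.sum_congr rfl fun b' _ => ?_
  rw [map_smul, Pi.smul_apply, smul_eq_mul]
  ring

theorem renewalInvariant_of_isStationaryDist {d k : ℕ} (hdk : d ≤ k) {p : ℕ → ℝ} {p10 q : ℝ}
    {Bmax : ℕ} {πB : Fin (Bmax + 1) → ℝ}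
    (h : IsStationaryDist (renewalTrans d k p p10 q Bmax) πB) :
    RenewalInvariant (zeroProb d k p) p10 q k πB := by
  intro f
  have h1 : batteryMean πB f = ∑ b' : Fin (Bmax + 1),
      (∑ b, πB b * renewalTrans d k p p10 q Bmax b b') * f b' := by
    rw [batteryMean_apply]
    refine Finset.sum_congr rfl fun b' _ => ?_
    exact congrArg (· * f b') (congrFun h.2 b').symm
  rw [h1]
  simp only [Finset.sum_mul]
  rw [Finset.sum_comm]
  simp only [batteryMean_apply, Finset.mul_sum]
  rw [Finset.sum_comm]
  refine Finset.sum_congr rfl fun b _ => ?_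
  simp only [mul_left_comm _ (πB b), mul_assoc, ← Finset.mul_sum]
  congr 1
  simp only [mul_comm _ (f _)]
  rw [sum_mul_renewalTrans hdk p p10 q f b]
  simp only [mul_assoc]

theorem exists_isStationaryDist_renewalTrans {d k : ℕ} (hdk : d ≤ k) {p : ℕ → ℝ}
    (hp : ∀ j, d ≤ j → j < k → p j ∈ Set.Ioo (0 : ℝ) 1) {p10 q : ℝ} (Bmax : ℕ)
    (hp10 : p10 ∈ Set.Icc (0 : ℝ) 1) (hq : q ∈ Set.Icc (0 : ℝ) 1) :
    ∃ πB, IsStationaryDist (renewalTrans d k p p10 q Bmax) πB := by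
  have hz : ∀ c, zeroProb d k p c ∈ Set.Icc (0 : ℝ) 1 := zeroProb_mem hp
  refine exists_isStationaryDist _ (fun b b' => ?_) fun b => ?_
  · rw [renewalTrans_eq hdk]
    refine Finset.sum_nonneg fun c _ => mul_nonneg
      (mul_nonneg (survival_nonneg hz c) (sub_nonneg.2 (hz c).2)) ?_
    rw [← energyMean_renewalWord_battery]
    refine (energyMean_const p10 q 0 (renewalWord (c + 1))).ge.trans ?_
    refine energyMean_mono hp10 hq _ fun y u => ?_
    split_ifs <;> norm_num
  · have h := sum_mul_renewalTrans hdk p p10 q (fun _ => 1) b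
    simp only [one_mul, energyOp_const, energyOp_pow_const, mul_one] at h
    rw [h, sum_survival_mul_one_sub fun c h => zeroProb_of_le p h]

/-! ### Explicit formulas -/

theorem energyOp_false_apply (p10 q : ℝ) {Bmax b : ℕ} (hb : b ≤ Bmax) (h : ℕ → ℝ) :
    energyOp p10 q Bmax false h b = (1 - q) * h b + q * h (b - 1) := by
  have h1 : b - 1 ≤ Bmax := (Nat.sub_le _ _).trans hb
  rw [energyOp_apply, Fintype.sum_prod_type]
  simp [chan, useProb, batteryStep, hb, h1]
  ring

/-- During the 0's the battery can only lose charge, so an overflow requires a full initial battery,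
no usage at all, and reception of the final 1. -/
theorem intervalReward_overflow (p10 q : ℝ) {Bmax : ℕ} (hB : 1 ≤ Bmax) (m : ℕ) {b : ℕ}
    (hb : b ≤ Bmax) :
    intervalReward p10 q Bmax (overflowReward Bmax) m b =
      if b = Bmax then (1 - p10) * (1 - q) ^ (m + 1) else 0 := by
  induction m generalizing b with
  | zero =>
    rw [intervalReward_zero, inputReward, Fintype.sum_prod_type]
    simp [chan, useProb, overflowReward]
  | succ m ih =>
    rw [intervalReward_succ, Pi.add_apply, energyOp_false_apply p10 q hb, ih hb,
      ih ((Nat.sub_le _ _).trans hb)]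
    have h1 : inputReward p10 q (overflowReward Bmax) false b = 0 := by
      rw [inputReward, Fintype.sum_prod_type]
      simp [chan, useProb, overflowReward]
    -- This uses `1 ≤ Bmax`: with truncated subtraction, a battery of capacity 0 would remain full
    -- after a usage.
    have h2 : b - 1 ≠ Bmax := by omega
    rw [h1, if_neg h2]
    split_ifs <;> ring

/-- Mean of a function of a binomial variable. -/
def binomMean (q : ℝ) (m : ℕ) (f : ℕ → ℝ) : ℝ := ∑ j ∈ Finset.range (m + 1), binom j m q * f j

theorem binomMean_succ (q : ℝ) (m : ℕ) (f : ℕ → ℝ) :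
    binomMean q (m + 1) f =
      (1 - q) * binomMean q m f + q * binomMean q m fun j => f (j + 1) := by
  have h1 : (1 - q) * binomMean q m f = ∑ j ∈ Finset.range (m + 1),
      (m.choose (j + 1) : ℝ) * q ^ (j + 1) * (1 - q) ^ (m - j) * f (j + 1) +
        (1 - q) ^ (m + 1) * f 0 := by
    rw [binomMean, Finset.sum_range_succ', Finset.sum_range_succ, Nat.choose_succ_self, mul_add,
      Finset.mul_sum]
    simp only [Nat.cast_zero, zero_mul, add_zero, binom]
    congr 1
    · refine Finset.sum_congr rfl fun j hj => ?_
      have : m - j = m - (j + 1) + 1 := by have := Finset.mem_range.1 hj; omega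
      rw [this, pow_succ]
      ring
    · simp; ring
  have h2 : (q * binomMean q m fun j => f (j + 1)) = ∑ j ∈ Finset.range (m + 1),
      (m.choose j : ℝ) * q ^ (j + 1) * (1 - q) ^ (m - j) * f (j + 1) := by
    rw [binomMean, Finset.mul_sum]
    refine Finset.sum_congr rfl fun j _ => ?_
    simp only [binom]
    ring
  rw [h1, h2, binomMean, Finset.sum_range_succ', add_right_comm, ← Finset.sum_add_distrib]
  congr 1
  · refine Finset.sum_congr rfl fun j _ => ?_
    rw [binom, Nat.choose_succ_succ, Nat.add_sub_add_right]
    push_cast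
    ring
  · simp [binom]

theorem binomMean_const (q : ℝ) (m : ℕ) (a : ℝ) : binomMean q m (fun _ => a) = a := by
  induction m with
  | zero => simp [binomMean, binom]
  | succ m ih => rw [binomMean_succ, ih]; ring

theorem binomMean_add (q : ℝ) (m : ℕ) (f g : ℕ → ℝ) :
    binomMean q m (fun j => f j + g j) = binomMean q m f + binomMean q m g := by
  simp only [binomMean, mul_add, Finset.sum_add_distrib]

/-- Conditioning on the first trial: a success lowers the remaining level by one, or counts
immediately if the level is 0. The truncated `0 - 1 = 0` keeps the level at 0 in the latter case. -/
theorem binomMean_excess_succ (q : ℝ) (m b : ℕ) :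
    binomMean q (m + 1) (fun j => ((j - b : ℕ) : ℝ)) = (if b = 0 then q else 0) +
      ((1 - q) * binomMean q m (fun j => ((j - b : ℕ) : ℝ)) +
        q * binomMean q m (fun j => ((j - (b - 1) : ℕ) : ℝ))) := by
  rw [binomMean_succ]
  cases b with
  | zero =>
    have : (fun j : ℕ => ((j + 1 - 0 : ℕ) : ℝ)) = fun j : ℕ => ((j - (0 - 1) : ℕ) : ℝ) + 1 := by
      ext j; simp
    rw [this, binomMean_add, binomMean_const, if_pos rfl]
    ring
  | succ b =>
    have : (fun j : ℕ => ((j + 1 - (b + 1) : ℕ) : ℝ)) =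
        fun j : ℕ => ((j - (b + 1 - 1) : ℕ) : ℝ) := by
      ext j; congr 1; omega
    rw [this, if_neg (Nat.succ_ne_zero b), zero_add]

theorem binomMean_excess (q : ℝ) (m b : ℕ) :
    binomMean q m (fun j => ((j - b : ℕ) : ℝ)) =
      ∑ l ∈ Finset.Icc 1 (m - b), (l : ℝ) * binom (l + b) m q := by
  symm
  refine Finset.sum_of_injOn (fun l => l + b) (fun _ _ _ _ h => Nat.add_right_cancel h) ?_ ?_ ?_
  · intro l hl
    simp only [Finset.coe_Icc, Set.mem_Icc, Finset.coe_range, Set.mem_Iio] at hl ⊢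
    omega
  · intro j hj h
    have : j - b = 0 := by
      by_contra h0
      refine h ⟨j - b, ?_, ?_⟩
      · simp only [Finset.mem_range, Finset.coe_Icc, Set.mem_Icc] at hj ⊢
        omega
      · show j - b + b = j
        omega
    simp [this]
  · intro l _
    simp [mul_comm]

/-- Without charging, the underflows are the usages in excess of `b`. If the final 1 is received,
its slot cannot underflow and only `m` usages matter; if it is lost, all `m + 1` do. -/
theorem intervalReward_underflow (p10 q : ℝ) {Bmax : ℕ} (m : ℕ) {b : ℕ} (hb : b ≤ Bmax) :
    intervalReward p10 q Bmax underflowReward m b =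
      (1 - p10) * binomMean q m (fun j => ((j - b : ℕ) : ℝ)) +
        p10 * binomMean q (m + 1) (fun j => ((j - b : ℕ) : ℝ)) := by
  induction m generalizing b with
  | zero =>
    rw [intervalReward_zero, inputReward, Fintype.sum_prod_type, binomMean_excess_succ]
    simp [chan, useProb, underflowReward, binomMean, binom]
  | succ m ih =>
    have h1 : inputReward p10 q underflowReward false b = if b = 0 then q else 0 := by
      rw [inputReward, Fintype.sum_prod_type]
      simp [chan, useProb, underflowReward]
    rw [intervalReward_succ, Pi.add_apply, energyOp_false_apply p10 q hb, ih hb,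
      ih ((Nat.sub_le _ _).trans hb), h1, binomMean_excess_succ q (m + 1),
      binomMean_excess_succ q m b]
    ring

theorem renewalOverflows_top {d k : ℕ} (hdk : d ≤ k) (p : ℕ → ℝ) (p10 q : ℝ) {Bmax : ℕ}
    (hB : 1 ≤ Bmax) :
    renewalOverflows d k p p10 q Bmax Bmax =
      ∑ i ∈ Finset.Icc (d + 1) (k + 1), intervalProb d k p i * ((1 - p10) * binom 0 i q) := by
  rw [renewalOverflows_eq hdk, sum_intervalProb_mul hdk p fun i => (1 - p10) * binom 0 i q]
  refine Finset.sum_congr rfl fun c _ => ?_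
  rw [intervalReward_overflow p10 q hB c le_rfl, if_pos rfl]
  simp [binom]

theorem renewalOverflows_eq_zero {d k : ℕ} (hdk : d ≤ k) (p : ℕ → ℝ) (p10 q : ℝ) {Bmax b : ℕ}
    (hb : b < Bmax) : renewalOverflows d k p p10 q Bmax b = 0 := by
  rw [renewalOverflows_eq hdk]
  refine Finset.sum_eq_zero fun c _ => ?_
  rw [intervalReward_overflow p10 q (Nat.one_le_of_lt hb) c hb.le, if_neg hb.ne, mul_zero]

theorem renewalUnderflows_formula {d k : ℕ} (hdk : d ≤ k) (p : ℕ → ℝ) (p10 q : ℝ) {Bmax b : ℕ}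
    (hb : b ≤ Bmax) :
    renewalUnderflows d k p p10 q Bmax b =
      ∑ i ∈ Finset.Icc (d + 1) (k + 1), intervalProb d k p i *
        ((1 - p10) * ∑ l ∈ Finset.Icc 1 (i - b - 1), (l : ℝ) * binom (l + b) (i - 1) q +
          p10 * ∑ l ∈ Finset.Icc 1 (i - b), (l : ℝ) * binom (l + b) i q) := by
  rw [renewalUnderflows_eq hdk, sum_intervalProb_mul hdk p fun i =>
    (1 - p10) * ∑ l ∈ Finset.Icc 1 (i - b - 1), (l : ℝ) * binom (l + b) (i - 1) q +
      p10 * ∑ l ∈ Finset.Icc 1 (i - b), (l : ℝ) * binom (l + b) i q]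
  refine Finset.sum_congr rfl fun c _ => ?_
  rw [intervalReward_underflow p10 q c hb, binomMean_excess, binomMean_excess,
    show c + 1 - b - 1 = c - b by omega, Nat.add_sub_cancel]

/-! ### The long-run frequencies as cycle averages -/

theorem batteryMean_sum_smul {Bmax : ℕ} (πB : Fin (Bmax + 1) → ℝ) {ι : Type*} (s : Finset ι)
    (w : ι → ℝ) (f : ι → ℕ → ℝ) :
    batteryMean πB (∑ c ∈ s, w c • f c) = ∑ b, πB b * ∑ c ∈ s, w c * f c b := by
  simp only [map_sum, map_smul, batteryMean_apply, smul_eq_mul, Finset.mul_sum]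
  rw [Finset.sum_comm]
  exact Finset.sum_congr rfl fun _ _ => Finset.sum_congr rfl fun _ _ => mul_left_comm _ _ _

theorem underflowBound_eq_cycle {d k : ℕ} (hdk : d ≤ k) (p : ℕ → ℝ) (p10 q : ℝ) {Bmax : ℕ}
    (πB : Fin (Bmax + 1) → ℝ) :
    underflowBound d k p p10 q Bmax πB =
      cycleSum (zeroProb d k p) p10 q k πB (slotReward (zeroProb d k p) p10 q
        fun _ b ω => underflowReward b ω.2.1 ω.2.2) / cycleLength (zeroProb d k p) k := by
  rw [cycleSum_slotReward (fun c h => zeroProb_of_le p h), underflowBound,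
    meanInterval_eq_cycleLength hdk, batteryMean_sum_smul]
  simp only [renewalUnderflows_eq hdk]

theorem overflowBound_eq_cycle {d k : ℕ} (hdk : d ≤ k) (p : ℕ → ℝ) (p10 q : ℝ) {Bmax : ℕ}
    (πB : Fin (Bmax + 1) → ℝ) :
    overflowBound d k p p10 q Bmax πB =
      cycleSum (zeroProb d k p) p10 q k πB (slotReward (zeroProb d k p) p10 q
        fun _ b ω => overflowReward Bmax b ω.2.1 ω.2.2) / cycleLength (zeroProb d k p) k := by
  rw [cycleSum_slotReward (fun c h => zeroProb_of_le p h), overflowBound,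
    meanInterval_eq_cycleLength hdk, batteryMean_sum_smul]
  simp only [← renewalOverflows_eq hdk]
  congr 1
  -- Only intervals started with a full battery contain overflows.
  rw [Finset.sum_eq_single (Fin.last Bmax)]
  · simp
  · intro b _ hb
    rw [renewalOverflows_eq_zero hdk p p10 q (Fin.val_lt_last hb), mul_zero]
  · simp

/-! ### Random codebooks with independent codewords -/

/-- Mean over codebooks of `M` independent codewords with law `P`. -/
def codebookMean {X : Type*} [Fintype X] (P : X → ℝ) {M : ℕ} (F : (Fin M → X) → ℝ) : ℝ :=
  ∑ x : Fin M → X, (∏ m, P (x m)) * F x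

section Codebook

variable {X : Type*} [Fintype X] {P : X → ℝ} {M : ℕ}

theorem codebookMean_mono (hP : ∀ x, 0 ≤ P x) {F G : (Fin M → X) → ℝ} (h : ∀ x, F x ≤ G x) :
    codebookMean P F ≤ codebookMean P G :=
  Finset.sum_le_sum fun x _ => mul_le_mul_of_nonneg_left (h x) (Finset.prod_nonneg fun _ _ => hP _)

theorem codebookMean_add (F G : (Fin M → X) → ℝ) :
    codebookMean P (fun x => F x + G x) = codebookMean P F + codebookMean P G := by
  simp only [codebookMean, mul_add, Finset.sum_add_distrib]

theorem codebookMean_sum {ι : Type*} (s : Finset ι) (F : ι → (Fin M → X) → ℝ) :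
    codebookMean P (fun x => ∑ i ∈ s, F i x) = ∑ i ∈ s, codebookMean P (F i) := by
  simp only [codebookMean, Finset.mul_sum]
  exact Finset.sum_comm

theorem codebookMean_div (F : (Fin M → X) → ℝ) (a : ℝ) :
    codebookMean P (fun x => F x / a) = codebookMean P F / a := by
  simp only [codebookMean, Finset.sum_div, mul_div_assoc]

theorem codebookMean_pair (hP : ∑ x, P x = 1) {m m' : Fin M} (hm : m ≠ m') (f h : X → ℝ) :
    codebookMean P (fun x => f (x m) * h (x m')) = (∑ a, P a * f a) * ∑ a, P a * h a := by
  classical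
  have h1 : ∀ x : Fin M → X, (∏ i, P (x i)) * (f (x m) * h (x m')) =
      ∏ i, P (x i) * ((if i = m then f (x i) else 1) * (if i = m' then h (x i) else 1)) := by
    intro x
    rw [Finset.prod_mul_distrib, Finset.prod_mul_distrib]
    simp
  have h2 := Finset.prod_univ_sum (fun _ : Fin M => (Finset.univ : Finset X))
    (fun i a => P a * ((if i = m then f a else 1) * (if i = m' then h a else 1)))
  rw [Fintype.piFinset_univ] at h2
  simp only [codebookMean, h1]
  rw [← h2]
  have h3 : ∀ i, ∑ a, P a * ((if i = m then f a else 1) * (if i = m' then h a else 1)) =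
      (if i = m then ∑ a, P a * f a else 1) * (if i = m' then ∑ a, P a * h a else 1) := by
    intro i
    by_cases h4 : i = m
    · subst h4
      simp [hm]
    · by_cases h5 : i = m' <;> simp only [h4, h5, if_true, if_false, mul_one, hP]
      simp [hm.symm]
  simp only [h3, Finset.prod_mul_distrib]
  simp

theorem codebookMean_const (hP : ∑ x, P x = 1) (a : ℝ) :
    codebookMean P (fun _ : Fin M → X => a) = a := by
  classical
  have h2 := Finset.prod_univ_sum (fun _ : Fin M => (Finset.univ : Finset X)) (fun _ a => P a)
  rw [Fintype.piFinset_univ] at h2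
  simp [codebookMean, ← Finset.sum_mul, ← h2, hP]

theorem codebookMean_single (hP : ∑ x, P x = 1) (m : Fin M) (f : X → ℝ) :
    codebookMean P (fun x => f (x m)) = ∑ a, P a * f a := by
  classical
  have h1 : ∀ x : Fin M → X, (∏ i, P (x i)) * f (x m) =
      ∏ i, P (x i) * (if i = m then f (x i) else 1) := by
    intro x
    rw [Finset.prod_mul_distrib]
    simp
  have h2 := Finset.prod_univ_sum (fun _ : Fin M => (Finset.univ : Finset X))
    (fun i a => P a * (if i = m then f a else 1))
  rw [Fintype.piFinset_univ] at h2
  simp only [codebookMean, h1]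
  rw [← h2]
  have h3 : ∀ i, ∑ a, P a * (if i = m then f a else 1) =
      (if i = m then ∑ a, P a * f a else 1) := by
    intro i
    by_cases h4 : i = m <;> simp [h4, hP]
  simp only [h3]
  simp

theorem codebookMean_average (hP : ∑ x, P x = 1) (hM : 0 < M) (f : X → ℝ) :
    codebookMean P (fun x : Fin M → X => (∑ m, f (x m)) / M) = ∑ a, P a * f a := by
  have : (M : ℝ) ≠ 0 := Nat.cast_ne_zero.2 hM.ne'
  rw [codebookMean_div, codebookMean_sum]
  simp only [codebookMean_single hP, Finset.sum_const, Finset.card_univ, Fintype.card_fin,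
    nsmul_eq_mul]
  exact mul_div_cancel_left₀ _ this

/-- Some codebook of positive probability is at most as bad as the average. -/
theorem exists_le_codebookMean (hP0 : ∀ x, 0 ≤ P x) (hP : ∑ x, P x = 1)
    (F : (Fin M → X) → ℝ) : ∃ x, (∀ m, 0 < P (x m)) ∧ F x ≤ codebookMean P F := by
  by_contra! h
  have h1 : ∀ x : Fin M → X, (∏ m, P (x m)) * codebookMean P F ≤ (∏ m, P (x m)) * F x := by
    intro x
    by_cases hx : ∀ m, 0 < P (x m)
    · exact mul_le_mul_of_nonneg_left (h x hx).le (Finset.prod_nonneg fun m _ => hP0 _)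
    · obtain ⟨m, hm⟩ := not_forall.1 hx
      have : ∏ m, P (x m) = 0 :=
        Finset.prod_eq_zero (Finset.mem_univ m) (le_antisymm (not_lt.1 hm) (hP0 _))
      simp [this]
  -- `F` and the constant `codebookMean P F` have the same mean, so the termwise inequalities are
  -- equalities. A positive weight would contradict strictness, so all weights vanish, against total
  -- mass one.
  have h2 := codebookMean_const (M := M) hP (codebookMean P F)
  have h3 := (Finset.sum_eq_sum_iff_of_le fun x _ => h1 x).1 h2
  have h4 : ∀ x : Fin M → X, ∏ m, P (x m) = 0 := by
    intro x
    by_contra h5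
    have h6 : ∀ m, 0 < P (x m) := fun m =>
      lt_of_le_of_ne (hP0 _) fun h7 => h5 (Finset.prod_eq_zero (Finset.mem_univ m) h7.symm)
    have h7 := h3 x (Finset.mem_univ x)
    exact (h x h6).ne (mul_left_cancel₀ h5 h7)
  have h5 := codebookMean_const (M := M) hP 1
  simp [codebookMean, h4] at h5

/-- Threshold decoding of a random code, for a metric `φ` of mean at most one on an independent
codeword. -/
theorem exists_decoder {Y : Type*} [Fintype Y] (hP0 : ∀ x, 0 ≤ P x) (hP : ∑ x, P x = 1)
    {W φ : X → Y → ℝ} (hW0 : ∀ x y, 0 ≤ W x y) (hW : ∀ x, ∑ y, W x y = 1)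
    (hφ0 : ∀ x y, 0 ≤ φ x y) (hφ : ∀ y, ∑ x, P x * φ x y ≤ 1) (hM : 0 < M) {T : ℝ} (hT : 0 < T) :
    ∃ g : (Fin M → X) → Y → Fin M,
      codebookMean P (fun x => (∑ m, ∑ y, if g x y = m then 0 else W (x m) y) / M) ≤
        ∑ x, P x * ∑ y, W x y * (if φ x y < T then 1 else 0) + (M - 1) / T := by
  classical
  -- The decoder outputs any message whose metric reaches the threshold, and message 0 if there is
  -- none.
  let g : (Fin M → X) → Y → Fin M := fun x y =>
    if h : ∃ m, T ≤ φ (x m) y then h.choose else ⟨0, hM⟩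
  refine ⟨g, ?_⟩
  -- Union bound: an error means that the true codeword misses the threshold or that another one
  -- reaches it, and then `1 ≤ φ / T` for that codeword.
  have key : ∀ x m y, (if g x y = m then 0 else W (x m) y) ≤
      W (x m) y * (if φ (x m) y < T then 1 else 0) +
        ∑ m' ∈ Finset.univ.erase m, W (x m) y * φ (x m') y / T := by
    intro x m y
    have hn : ∀ m', 0 ≤ W (x m) y * φ (x m') y / T := fun m' =>
      div_nonneg (mul_nonneg (hW0 _ _) (hφ0 _ _)) hT.le
    have hs := Finset.sum_nonneg fun m' (_ : m' ∈ Finset.univ.erase m) => hn m'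
    split_ifs with h1 h2 h2
    · have := hW0 (x m) y
      linarith
    · linarith
    · linarith
    · have hex : ∃ m, T ≤ φ (x m) y := ⟨m, not_lt.1 h2⟩
      have hg : g x y = hex.choose := dif_pos hex
      have h3 := hex.choose_spec
      rw [← hg] at h3
      have h4 : W (x m) y ≤ W (x m) y * φ (x (g x y)) y / T := by
        rw [le_div_iff₀ hT]
        exact mul_le_mul_of_nonneg_left h3 (hW0 _ _)
      have h5 := Finset.single_le_sum (f := fun m' => W (x m) y * φ (x m') y / T)
        (fun m' _ => hn m') (Finset.mem_erase.2 ⟨h1, Finset.mem_univ (g x y)⟩)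
      linarith
  set A : X → ℝ := fun a => ∑ y, W a y * (if φ a y < T then 1 else 0)
  have hM' : (0 : ℝ) < M := Nat.cast_pos.2 hM
  have h1 : ∀ x : Fin M → X, (∑ m, ∑ y, if g x y = m then 0 else W (x m) y) / (M : ℝ) ≤
      (∑ m, A (x m)) / M +
        (∑ m, ∑ m' ∈ Finset.univ.erase m, (∑ y, W (x m) y * φ (x m') y) / T) / M := by
    intro x
    rw [← add_div, ← Finset.sum_add_distrib]
    refine div_le_div_of_nonneg_right (Finset.sum_le_sum fun m _ => ?_) hM'.le
    refine (Finset.sum_le_sum fun y _ => key x m y).trans_eq ?_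
    rw [Finset.sum_add_distrib, Finset.sum_comm]
    simp only [A, Finset.sum_div]
  have h2 : ∀ m, ∀ m' ∈ Finset.univ.erase m,
      codebookMean P (fun x : Fin M → X => (∑ y, W (x m) y * φ (x m') y) / T) ≤ 1 / T := by
    intro m m' hm'
    rw [codebookMean_div, codebookMean_sum]
    refine div_le_div_of_nonneg_right ?_ hT.le
    calc ∑ y, codebookMean P (fun x : Fin M → X => W (x m) y * φ (x m') y)
        = ∑ y, (∑ a, P a * W a y) * ∑ a, P a * φ a y :=
          Finset.sum_congr rfl fun y _ => codebookMean_pair hP (Finset.ne_of_mem_erase hm').symm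
            (fun a => W a y) (fun a => φ a y)
      _ ≤ ∑ y, (∑ a, P a * W a y) * 1 := Finset.sum_le_sum fun y _ =>
          mul_le_mul_of_nonneg_left (hφ y)
            (Finset.sum_nonneg fun a _ => mul_nonneg (hP0 a) (hW0 a y))
      _ = 1 := by
          simp only [mul_one]
          rw [Finset.sum_comm]
          simp only [← Finset.mul_sum, hW, mul_one, hP]
  refine (codebookMean_mono hP0 h1).trans ?_
  rw [codebookMean_add, codebookMean_average hP hM A, codebookMean_div, codebookMean_sum]
  refine add_le_add le_rfl ?_
  rw [div_le_iff₀ hM']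
  calc _ ≤ ∑ m : Fin M, ∑ m' ∈ Finset.univ.erase m, 1 / T := Finset.sum_le_sum fun m _ => by
          rw [codebookMean_sum]
          exact Finset.sum_le_sum (h2 m)
    _ = _ := by
      simp only [Finset.sum_const, Finset.card_erase_of_mem (Finset.mem_univ _),
        Finset.card_univ, Fintype.card_fin, nsmul_eq_mul]
      rw [Nat.cast_sub hM]
      push_cast
      ring

end Codebook

/-! ### The likelihood ratio of the channel output given the code state -/

/-- Probability of the output `y` in code state `c`. -/
def outProb (z : ℕ → ℝ) (p10 : ℝ) (c : ℕ) (y : Bool) : ℝ := ∑ a, symProb z c a * chan p10 a y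

/-- Product over the slots of the likelihood ratios of the output, conditional on the state. -/
noncomputable def ratio (z : ℕ → ℝ) (p10 : ℝ) : ∀ {n : ℕ}, ℕ → Word n → Word n → ℝ
  | 0, _, _, _ => 1
  | _ + 1, c, x, y => chan p10 (x 0) (y 0) / outProb z p10 c (y 0) *
      ratio z p10 (nextState c (x 0)) (Fin.tail x) (Fin.tail y)

/-- Information density of a slot, in bits. -/
noncomputable def infoReward (z : ℕ → ℝ) (p10 : ℝ) (c _b : ℕ) (ω : Bool × Bool × Bool) : ℝ :=
  Real.logb 2 (chan p10 ω.1 ω.2.1 / outProb z p10 c ω.2.1)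

section Ratio

variable {z : ℕ → ℝ} {p10 q : ℝ}

theorem outProb_nonneg (hz : ∀ c, z c ∈ Set.Icc (0 : ℝ) 1) (hp : p10 ∈ Set.Icc (0 : ℝ) 1) (c : ℕ)
    (y : Bool) : 0 ≤ outProb z p10 c y :=
  Finset.sum_nonneg fun _ _ => mul_nonneg (symProb_nonneg hz _ _) (chan_nonneg hp _ _)

theorem ratio_nonneg (hz : ∀ c, z c ∈ Set.Icc (0 : ℝ) 1) (hp : p10 ∈ Set.Icc (0 : ℝ) 1) :
    ∀ {n : ℕ} (c : ℕ) (x y : Word n), 0 ≤ ratio z p10 c x y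
  | 0, _, _, _ => zero_le_one
  | _ + 1, _, _, _ => mul_nonneg (div_nonneg (chan_nonneg hp _ _) (outProb_nonneg hz hp _ _))
      (ratio_nonneg hz hp _ _ _)

/-- Given the state, one slot's ratio averages to `outProb / outProb`, and the remaining slots are
bounded recursively. Only an inequality holds, because an output of probability zero yields `0 / 0 =
0`. -/
theorem sum_wordProbFrom_mul_ratio_le (hz : ∀ c, z c ∈ Set.Icc (0 : ℝ) 1)
    (hp : p10 ∈ Set.Icc (0 : ℝ) 1) : ∀ {n : ℕ} (c : ℕ) (y : Word n),
      ∑ x, wordProbFrom z c x * ratio z p10 c x y ≤ 1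
  | 0, _, _ => by simp [wordProbFrom, ratio]
  | n + 1, c, y => by
    rw [sum_fin_succ_pi]
    calc ∑ a, ∑ x : Word n, wordProbFrom z c (Fin.cons a x : Word (n + 1)) *
          ratio z p10 c (Fin.cons a x : Word (n + 1)) y
        = ∑ a, symProb z c a * chan p10 a (y 0) / outProb z p10 c (y 0) *
            ∑ x : Word n, wordProbFrom z (nextState c a) x *
              ratio z p10 (nextState c a) x (Fin.tail y) := by
          refine Finset.sum_congr rfl fun a _ => ?_
          rw [Finset.mul_sum]
          refine Finset.sum_congr rfl fun x _ => ?_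
          rw [wordProbFrom_cons, ratio, Fin.cons_zero, Fin.tail_cons]
          ring
      _ ≤ ∑ a, symProb z c a * chan p10 a (y 0) / outProb z p10 c (y 0) * 1 :=
          Finset.sum_le_sum fun a _ => mul_le_mul_of_nonneg_left
            (sum_wordProbFrom_mul_ratio_le hz hp _ _)
            (div_nonneg (mul_nonneg (symProb_nonneg hz _ _) (chan_nonneg hp _ _))
              (outProb_nonneg hz hp _ _))
      _ = outProb z p10 c (y 0) / outProb z p10 c (y 0) := by
          simp only [mul_one, ← Finset.sum_div]
          rfl
      _ ≤ 1 := div_self_le_one _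

/-- On paths of positive probability all ratios are positive, so the logarithm of the product is a
sum. The battery is carried along only to fit the format of rewards. -/
theorem logb_ratio (hz : ∀ c, z c ∈ Set.Icc (0 : ℝ) 1) (hp : p10 ∈ Set.Icc (0 : ℝ) 1)
    (Bmax : ℕ) : ∀ {n : ℕ} (c b : ℕ) (x y u : Word n),
      wordProbFrom z c x * chanProb p10 x y ≠ 0 → 0 < ratio z p10 c x y ∧
        Real.logb 2 (ratio z p10 c x y) = rewardSum Bmax (infoReward z p10) c b x y u
  | 0, _, _, _, _, _, _ => by simp [ratio, rewardSum]
  | n + 1, c, b, x, y, u, h => by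
    rw [← Fin.cons_self_tail x, ← Fin.cons_self_tail y, wordProbFrom_cons, chanProb_cons,
      mul_mul_mul_comm] at h
    obtain ⟨h1, h2⟩ := mul_ne_zero_iff.1 h
    obtain ⟨hs, hc⟩ := mul_ne_zero_iff.1 h1
    have ih := logb_ratio hz hp Bmax (nextState c (x 0)) (batteryStep Bmax b (y 0) (u 0))
      (Fin.tail x) (Fin.tail y) (Fin.tail u) h2
    have hc' : 0 < chan p10 (x 0) (y 0) := lt_of_le_of_ne (chan_nonneg hp _ _) hc.symm
    have hs' : 0 < symProb z c (x 0) := lt_of_le_of_ne (symProb_nonneg hz _ _) hs.symm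
    have ho : 0 < outProb z p10 c (y 0) := (mul_pos hs' hc').trans_le
      (Finset.single_le_sum (f := fun a => symProb z c a * chan p10 a (y 0))
        (fun a _ => mul_nonneg (symProb_nonneg hz _ _) (chan_nonneg hp _ _)) (Finset.mem_univ (x 0)))
    have hd : 0 < chan p10 (x 0) (y 0) / outProb z p10 c (y 0) := div_pos hc' ho
    refine ⟨mul_pos hd ih.1, ?_⟩
    rw [ratio, Real.logb_mul hd.ne' ih.1.ne', ih.2]
    rfl

/-- The reward depends on `c` only through `z c`, which is 0 from `k` on, so it takes finitely many
values; the conventions for division by 0 and the logarithm of 0 keep these real. -/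
theorem exists_infoReward_bound {k : ℕ} (hzk : ∀ c, k ≤ c → z c = 0) :
    ∃ K, ∀ c b ω, |infoReward z p10 c b ω| ≤ K := by
  refine ⟨∑ c ∈ Finset.range (k + 1), ∑ ω, |infoReward z p10 c 0 ω|, fun c b ω => ?_⟩
  have h1 : infoReward z p10 c b ω = infoReward z p10 (min c k) 0 ω := by
    have hzc : z c = z (min c k) := by
      rcases le_total c k with h | h
      · rw [min_eq_left h]
      · rw [min_eq_right h, hzk c h, hzk k le_rfl]
    have : ∀ a, symProb z c a = symProb z (min c k) a := by
      intro a; cases a <;> simp [symProb, hzc]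
    simp only [infoReward, outProb, this]
  rw [h1]
  refine le_trans ?_ (Finset.single_le_sum (f := fun c => ∑ ω, |infoReward z p10 c 0 ω|)
    (fun c _ => Finset.sum_nonneg fun _ _ => abs_nonneg _)
    (Finset.mem_range.2 (Nat.lt_succ_of_le (min_le_right c k))))
  exact Finset.single_le_sum (f := fun ω => |infoReward z p10 (min c k) 0 ω|)
    (fun _ _ => abs_nonneg _) (Finset.mem_univ ω)

/-- Splits the logarithm also when probabilities degenerate to 0, where the weight `w` vanishes. -/
theorem mul_logb_div_of_le {w t Q : ℝ} (hQ : w ≤ Q) (hw : 0 ≤ w) (ht : t = 0 → w = 0) :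
    w * Real.logb 2 (t / Q) = w * Real.logb 2 t - w * Real.logb 2 Q := by
  rcases hw.eq_or_lt with h | h
  · simp [← h]
  · rw [Real.logb_div (fun h0 => h.ne' (ht h0)) (h.trans_le hQ).ne', mul_sub]

theorem slotReward_infoReward (hz : ∀ c, z c ∈ Set.Icc (0 : ℝ) 1) (hp : p10 ∈ Set.Icc (0 : ℝ) 1)
    (c b : ℕ) : slotReward z p10 q (infoReward z p10) c b =
      binH ((1 - z c) * (1 - p10)) - (1 - z c) * binH p10 := by
  obtain ⟨hz0, hz1⟩ := hz c
  obtain ⟨hp0, hp1⟩ := hp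
  have h1 : slotReward z p10 q (infoReward z p10) c b =
      ∑ a, ∑ y, symProb z c a * chan p10 a y *
        Real.logb 2 (chan p10 a y / outProb z p10 c y) := by
    rw [slotReward, Fintype.sum_prod_type]
    refine Finset.sum_congr rfl fun a _ => ?_
    rw [Fintype.sum_prod_type]
    refine Finset.sum_congr rfl fun y _ => ?_
    simp only [slotProb, infoReward, Fintype.sum_bool, useProb]
    simp only [if_true, Bool.false_eq_true, if_false]
    ring
  have hQ1 : outProb z p10 c true = (1 - z c) * (1 - p10) := by
    simp [outProb, symProb, chan]
  have hQ0 : outProb z p10 c false = 1 - (1 - z c) * (1 - p10) := by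
    simp [outProb, symProb, chan]; ring
  rw [h1]
  simp only [Fintype.sum_bool, hQ1, hQ0, symProb, chan, mul_zero, zero_mul, zero_add, mul_one]
  have ha : 0 ≤ 1 - z c := by linarith
  have hb : 0 ≤ 1 - p10 := by linarith
  rw [mul_logb_div_of_le le_rfl (mul_nonneg ha hb) (fun h => by rw [h, mul_zero]),
    mul_logb_div_of_le (t := p10) (by nlinarith) (mul_nonneg ha hp0) (fun h => by rw [h, mul_zero]),
    mul_logb_div_of_le (t := 1) (by nlinarith) hz0 (fun h => absurd h one_ne_zero)]
  simp only [binH, Real.logb_one]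
  ring

/-- The stationary weights are the normalised survival probabilities. States outside `d ≤ j < k`
have forced symbols and contribute zero information: `H(0) = 0` below `d`, and `H(1 - p10) = H(p10)`
in state `k`. -/
theorem rateBound_eq_cycle {d k : ℕ} {p : ℕ → ℝ}
    (hpj : ∀ j, d ≤ j → j < k → p j ∈ Set.Ioo (0 : ℝ) 1) (hp : p10 ∈ Set.Icc (0 : ℝ) 1)
    {Bmax : ℕ} {π : Fin (k + 1) → ℝ} {πB : Fin (Bmax + 1) → ℝ}
    (hπ : IsStationaryDist (codeTrans d k p) π) (hπB : πB ∈ stdSimplex ℝ (Fin (Bmax + 1))) :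
    rateBound d k p π p10 =
      cycleSum (zeroProb d k p) p10 q k πB (slotReward (zeroProb d k p) p10 q
        (infoReward (zeroProb d k p) p10)) / cycleLength (zeroProb d k p) k := by
  have h1 : ∀ c, slotReward (zeroProb d k p) p10 q (infoReward (zeroProb d k p) p10) c =
      fun _ => binH ((1 - zeroProb d k p c) * (1 - p10)) -
        (1 - zeroProb d k p c) * binH p10 := by
    intro c
    ext b
    exact slotReward_infoReward (zeroProb_mem hpj) hp c b
  simp only [cycleSum, h1, energyOp_pow_const, batteryMean_apply, ← Finset.sum_mul, hπB.2, one_mul]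
  rw [rateBound, ← Fin.sum_univ_eq_sum_range (fun c => survival (zeroProb d k p) c *
    (binH ((1 - zeroProb d k p c) * (1 - p10)) - (1 - zeroProb d k p c) * binH p10)),
    Finset.sum_div, Finset.sum_filter]
  refine Finset.sum_congr rfl fun c _ => ?_
  rw [(isStationaryDist_codeTrans_iff hpj π).1 hπ c]
  split_ifs with h
  · have : zeroProb d k p c = p c := by simp [zeroProb, not_lt.2 h.1, h.2]
    rw [this]
    ring
  · by_cases hk : (c : ℕ) < k
    · have hd : (c : ℕ) < d := by
        by_contra h2
        exact h ⟨not_lt.1 h2, hk⟩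
      have : zeroProb d k p c = 1 := by simp [zeroProb, hd, hk]
      simp [this, binH]
    · rw [zeroProb_of_le p (not_lt.1 hk)]
      have : binH ((1 - 0) * (1 - p10)) - (1 - 0) * binH p10 = 0 := by
        simp only [binH, sub_zero, one_mul, sub_sub_cancel]
        ring
      rw [this]
      simp

end Ratio

/-! ### Error probability of the random code -/

theorem sum_usageProb (q : ℝ) : ∀ n : ℕ, ∑ u : Word n, usageProb q u = 1
  | 0 => by simp [usageProb]
  | n + 1 => by
    rw [sum_fin_succ_pi]
    simp only [usageProb_cons, ← Finset.mul_sum, sum_usageProb q n]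
    simp [useProb]

theorem energyMean_output (p10 q : ℝ) {n : ℕ} (x : Word n) (h : Word n → ℝ) :
    energyMean p10 q x (fun y _ => h y) = ∑ y, chanProb p10 x y * h y := by
  refine Finset.sum_congr rfl fun y _ => ?_
  simp only [mul_right_comm _ _ (h y), ← Finset.mul_sum, sum_usageProb, mul_one]

theorem sum_chanProb (p10 : ℝ) {n : ℕ} (x : Word n) : ∑ y, chanProb p10 x y = 1 := by
  have h := energyMean_output p10 0 x fun _ => 1
  rw [energyMean_const] at h
  simpa using h.symm

theorem blockMean_mono_of_support {z : ℕ → ℝ} {p10 q : ℝ} (hz : ∀ c, z c ∈ Set.Icc (0 : ℝ) 1)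
    (hp : p10 ∈ Set.Icc (0 : ℝ) 1) (hq : q ∈ Set.Icc (0 : ℝ) 1) {n : ℕ} (c : ℕ)
    {f g : Word n → Word n → Word n → ℝ}
    (h : ∀ x y u, wordProbFrom z c x * chanProb p10 x y ≠ 0 → f x y u ≤ g x y u) :
    blockMean z p10 q c f ≤ blockMean z p10 q c g := by
  simp only [blockMean, energyMean, Finset.mul_sum]
  refine Finset.sum_le_sum fun x _ => Finset.sum_le_sum fun y _ => Finset.sum_le_sum fun u _ => ?_
  have hw := wordProbFrom_nonneg hz c x
  have hc := chanProb_nonneg hp x y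
  have hu := usageProb_nonneg hq u
  simp only [← mul_assoc]
  by_cases h0 : wordProbFrom z c x * chanProb p10 x y = 0
  · simp [h0]
  · exact mul_le_mul_of_nonneg_left (h x y u h0) (by positivity)

section RandomCode

variable {d k : ℕ} {p : ℕ → ℝ} {π : Fin (k + 1) → ℝ} {p10 q : ℝ}

theorem wordProb_nonneg (hpj : ∀ j, d ≤ j → j < k → p j ∈ Set.Ioo (0 : ℝ) 1)
    (hπ : π ∈ stdSimplex ℝ (Fin (k + 1))) {n : ℕ} (x : Word n) : 0 ≤ wordProb d k p π x := by
  rw [wordProb_eq_sum]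
  exact Finset.sum_nonneg fun c _ => mul_nonneg (hπ.1 c) (wordProbFrom_nonneg (zeroProb_mem hpj) _ _)

theorem sum_wordProb (d : ℕ) (p : ℕ → ℝ) (hπ : π ∈ stdSimplex ℝ (Fin (k + 1))) (n : ℕ) :
    ∑ x : Word n, wordProb d k p π x = 1 := by
  simp only [wordProb_eq_sum]
  rw [Finset.sum_comm]
  simp only [← Finset.mul_sum, sum_wordProbFrom, mul_one, hπ.2]

/-- Posterior mean of the likelihood ratio given the codeword. -/
noncomputable def metric (d k : ℕ) (p : ℕ → ℝ) (π : Fin (k + 1) → ℝ) (p10 : ℝ) {n : ℕ}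
    (x y : Word n) : ℝ :=
  (∑ c, π c * wordProbFrom (zeroProb d k p) c x * ratio (zeroProb d k p) p10 c x y) /
    wordProb d k p π x

theorem sum_wordProb_mul_metric_le (hpj : ∀ j, d ≤ j → j < k → p j ∈ Set.Ioo (0 : ℝ) 1)
    (hp : p10 ∈ Set.Icc (0 : ℝ) 1) (hπ : π ∈ stdSimplex ℝ (Fin (k + 1))) {n : ℕ} (y : Word n) :
    ∑ x, wordProb d k p π x * metric d k p π p10 x y ≤ 1 := by
  have hz := zeroProb_mem hpj
  calc ∑ x, wordProb d k p π x * metric d k p π p10 x y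
      ≤ ∑ x, ∑ c, π c * wordProbFrom (zeroProb d k p) c x *
          ratio (zeroProb d k p) p10 c x y := by
        refine Finset.sum_le_sum fun x _ => ?_
        by_cases h0 : wordProb d k p π x = 0
        · rw [h0, zero_mul]
          exact Finset.sum_nonneg fun c _ => mul_nonneg
            (mul_nonneg (hπ.1 c) (wordProbFrom_nonneg hz _ _)) (ratio_nonneg hz hp _ _ _)
        · rw [metric, mul_div_cancel₀ _ h0]
    _ = ∑ c : Fin (k + 1), π c * ∑ x, wordProbFrom (zeroProb d k p) c x *
          ratio (zeroProb d k p) p10 c x y := by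
        rw [Finset.sum_comm]
        simp only [Finset.mul_sum, mul_assoc]
    _ ≤ ∑ c : Fin (k + 1), π c * 1 := Finset.sum_le_sum fun c _ =>
        mul_le_mul_of_nonneg_left (sum_wordProbFrom_mul_ratio_le hz hp _ _) (hπ.1 c)
    _ = 1 := by simp only [mul_one, hπ.2]

/-- If the ratio from the true initial state is at least `T * S` while the metric is below `T`, that
state has posterior weight at most `1 / S` given the codeword. Summing over the `k + 1` states
bounds this event by `(k + 1) / S`. -/
theorem metric_lt_prob_le (hpj : ∀ j, d ≤ j → j < k → p j ∈ Set.Ioo (0 : ℝ) 1)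
    (hp : p10 ∈ Set.Icc (0 : ℝ) 1) (hπ : π ∈ stdSimplex ℝ (Fin (k + 1))) {n : ℕ} {T S : ℝ}
    (hT : 0 < T) (hS : 0 < S) :
    ∑ x : Word n, wordProb d k p π x *
      ∑ y, chanProb p10 x y * (if metric d k p π p10 x y < T then 1 else 0) ≤
      ∑ c, π c * blockMean (zeroProb d k p) p10 q c (fun x y _ : Word n =>
        if ratio (zeroProb d k p) p10 c x y < T * S then 1 else 0) + (k + 1) / S := by
  have hz := zeroProb_mem hpj
  set z := zeroProb d k p
  have hle : ∀ (c : Fin (k + 1)) (x : Word n), π c * wordProbFrom z c x ≤ wordProb d k p π x := by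
    intro c x
    rw [wordProb_eq_sum]
    exact Finset.single_le_sum (f := fun c : Fin (k + 1) => π c * wordProbFrom z c x)
      (fun c _ => mul_nonneg (hπ.1 c) (wordProbFrom_nonneg hz _ _)) (Finset.mem_univ c)
  have key : ∀ (c : Fin (k + 1)) (x y : Word n),
      π c * wordProbFrom z c x * (if metric d k p π p10 x y < T then (1 : ℝ) else 0) ≤
        π c * wordProbFrom z c x * (if ratio z p10 c x y < T * S then 1 else 0) +
          wordProb d k p π x / S := by
    intro c x y
    have hP := wordProb_nonneg hpj hπ x
    have ha : 0 ≤ π c * wordProbFrom z c x := mul_nonneg (hπ.1 c) (wordProbFrom_nonneg hz _ _)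
    have hd : 0 ≤ wordProb d k p π x / S := div_nonneg hP hS.le
    split_ifs with h1 h2 h2
    · linarith
    · rw [mul_one, mul_zero, zero_add, le_div_iff₀ hS]
      rcases hP.eq_or_lt with h0 | h0
      · have := hle c x
        have h3 : π c * wordProbFrom z c x = 0 := le_antisymm (h0 ▸ this) ha
        rw [h3, zero_mul]
        exact hP
      · have h3 : π c * wordProbFrom z c x * ratio z p10 c x y ≤
            metric d k p π p10 x y * wordProb d k p π x := by
          rw [metric, div_mul_cancel₀ _ h0.ne']
          exact Finset.single_le_sum
            (f := fun c : Fin (k + 1) => π c * wordProbFrom z c x * ratio z p10 c x y)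
            (fun c _ => mul_nonneg (mul_nonneg (hπ.1 c) (wordProbFrom_nonneg hz _ _))
              (ratio_nonneg hz hp _ _ _)) (Finset.mem_univ c)
        have h4 := mul_le_mul_of_nonneg_left (not_lt.1 h2) ha
        have h5 := mul_le_mul_of_nonneg_right h1.le hP
        refine le_of_mul_le_mul_left ?_ hT
        linarith
    · linarith
    · linarith
  have h1 : ∀ x : Word n, wordProb d k p π x *
      ∑ y, chanProb p10 x y * (if metric d k p π p10 x y < T then 1 else 0) ≤
      ∑ c, π c * (wordProbFrom z c x * energyMean p10 q x (fun y _ =>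
        if ratio z p10 c x y < T * S then 1 else 0)) + (k + 1) / S * wordProb d k p π x := by
    intro x
    calc wordProb d k p π x *
          ∑ y, chanProb p10 x y * (if metric d k p π p10 x y < T then 1 else 0)
        = ∑ y, chanProb p10 x y * ∑ c : Fin (k + 1), π c * wordProbFrom z c x *
            (if metric d k p π p10 x y < T then 1 else 0) := by
          rw [Finset.mul_sum]
          refine Finset.sum_congr rfl fun y _ => ?_
          rw [← Finset.sum_mul, ← wordProb_eq_sum]
          ring
      _ ≤ ∑ y, chanProb p10 x y * ∑ c : Fin (k + 1), (π c * wordProbFrom z c x *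
            (if ratio z p10 c x y < T * S then 1 else 0) + wordProb d k p π x / S) :=
          Finset.sum_le_sum fun y _ => mul_le_mul_of_nonneg_left
            (Finset.sum_le_sum fun c _ => key c x y) (chanProb_nonneg hp x y)
      _ = _ := by
          simp only [energyMean_output, Finset.sum_add_distrib, mul_add, Finset.sum_const,
            Finset.card_univ, Fintype.card_fin, nsmul_eq_mul, ← Finset.sum_mul, sum_chanProb]
          congr 1
          · simp only [Finset.mul_sum]
            rw [Finset.sum_comm]
            exact Finset.sum_congr rfl fun _ _ => Finset.sum_congr rfl fun _ _ => by ring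
          · push_cast
            ring
  refine (Finset.sum_le_sum fun x _ => h1 x).trans_eq ?_
  rw [Finset.sum_add_distrib, ← Finset.mul_sum, sum_wordProb d p hπ, mul_one, Finset.sum_comm]
  simp only [← Finset.mul_sum]
  rfl

/-- Chebyshev's inequality for the information density. -/
theorem blockMean_ratio_lt_le {z : ℕ → ℝ} (hz : ∀ c, z c ∈ Set.Icc (0 : ℝ) 1)
    (hp : p10 ∈ Set.Icc (0 : ℝ) 1) (hq : q ∈ Set.Icc (0 : ℝ) 1) (Bmax : ℕ) {n : ℕ} (c b : ℕ)
    {g t θ V : ℝ} (ht : 0 < t) (hθ : θ ≤ n * g - t)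
    (hV : blockMean z p10 q c (fun x y u : Word n =>
      (rewardSum Bmax (infoReward z p10) c b x y u - n * g) ^ 2) ≤ V) :
    blockMean z p10 q c (fun x y _ : Word n =>
      if ratio z p10 c x y < (2 : ℝ) ^ θ then 1 else 0) ≤ V / t ^ 2 := by
  have ht2 : 0 < t ^ 2 := by positivity
  rw [le_div_iff₀ ht2, mul_comm]
  refine le_trans ?_ hV
  rw [← blockMean_const_mul]
  refine blockMean_mono_of_support hz hp hq c fun x y u h => ?_
  obtain ⟨h1, h2⟩ := logb_ratio hz hp Bmax c b x y u h
  split_ifs with h3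
  · have h4 : Real.logb 2 (ratio z p10 c x y) < θ := by
      rwa [Real.logb_lt_iff_lt_rpow one_lt_two h1]
    rw [h2] at h4
    rw [mul_one, ← neg_sq (_ - _)]
    exact pow_le_pow_left₀ ht.le (by linarith) 2
  · rw [mul_zero]
    positivity

end RandomCode

/-! ### Words of positive probability satisfy the runlength constraint -/

/-- The state counts the 0's since the last 1, on top of its initial value. Its bound `k` limits
every run, and the requirement of state at least `d` at each 1 separates successive 1's. -/
theorem isRLL_of_states {d k n : ℕ} {x : Word n} {s : ℕ → ℕ} (hk : ∀ i ≤ n, s i ≤ k)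
    (h0 : ∀ i (h : i < n), x ⟨i, h⟩ = false → s (i + 1) = s i + 1)
    (h1 : ∀ i (h : i < n), x ⟨i, h⟩ = true → s (i + 1) = 0 ∧ d ≤ s i) : IsRLL d k x := by
  have run : ∀ i j, i + j ≤ n → (∀ l (h : l < n), i ≤ l → l < i + j → x ⟨l, h⟩ = false) →
      s (i + j) = s i + j := by
    intro i j
    induction j with
    | zero => intro _ _; rfl
    | succ j ih =>
      intro hn hx
      have hn' : i + j < n := by omega
      rw [← add_assoc, h0 (i + j) hn' (hx _ hn' (Nat.le_add_right _ _) (by omega)),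
        ih (by omega) fun l h hl hl' => hx l h hl (by omega)]
      omega
  constructor
  · intro i hi
    by_contra! h
    -- A window of `k + 1` zeros would push the state above `k`.
    have := run i (k + 1) (by omega) fun l hl hil hlt => by
      have := h ⟨l, hl⟩ hil (by simp only; omega)
      simpa using this
    have := hk (i + (k + 1)) (by omega)
    omega
  · rintro ⟨i, hi⟩ ⟨j, hj⟩ hij hxi hxj hr
    simp only [Fin.mk_lt_mk] at hij
    have h2 := run (i + 1) (j - (i + 1)) (by omega) fun l hl hil hlt =>
      hr ⟨l, hl⟩ (by rw [Fin.mk_lt_mk]; omega) (by rw [Fin.mk_lt_mk]; omega)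
    rw [(h1 i hi hxi).1, show i + 1 + (j - (i + 1)) = j by omega] at h2
    have h3 := (h1 j hj hxj).2
    simp only
    omega

theorem isRLL_of_wordProb_pos {d k : ℕ} (hdk : d ≤ k) {p : ℕ → ℝ} {π : Fin (k + 1) → ℝ} {n : ℕ}
    {x : Word n} (h : 0 < wordProb d k p π x) : IsRLL d k x := by
  obtain ⟨c, -, hc⟩ := Finset.exists_ne_zero_of_sum_ne_zero h.ne'
  split_ifs at hc with hx
  swap
  · exact absurd rfl hc
  have htr : ∀ i : Fin n, codeTrans d k p (c i.castSucc) (c i.succ) ≠ 0 := fun i =>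
    Finset.prod_ne_zero_iff.1 (mul_ne_zero_iff.1 hc).2 i (Finset.mem_univ i)
  have hs : ∀ i (h : i < n + 1), (if h : i < n + 1 then (c ⟨i, h⟩ : ℕ) else 0) = c ⟨i, h⟩ :=
    fun i h => dif_pos h
  refine isRLL_of_states (s := fun i => if h : i < n + 1 then (c ⟨i, h⟩ : ℕ) else 0) ?_ ?_ ?_
  · intro i hi
    rw [hs i (Nat.lt_succ_of_le hi)]
    exact Nat.lt_succ_iff.1 (c _).2
  · intro i hi hxi
    rw [hs i (by omega), hs (i + 1) (by omega)]
    have h1 := htr ⟨i, hi⟩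
    have h2 : c (Fin.succ ⟨i, hi⟩) ≠ 0 := fun h => by
      have := (hx ⟨i, hi⟩).2 h
      simp [hxi] at this
    have h3 : ((c (Fin.succ ⟨i, hi⟩) : Fin (k + 1)) : ℕ) ≠ 0 := fun h => h2 (Fin.ext h)
    unfold codeTrans at h1
    rw [if_neg h3] at h1
    by_contra h4
    exact h1 (if_neg h4)
  · intro i hi hxi
    rw [hs i (by omega), hs (i + 1) (by omega)]
    have h1 := htr ⟨i, hi⟩
    have h2 : c (Fin.succ ⟨i, hi⟩) = 0 := (hx ⟨i, hi⟩).1 hxi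
    rw [h2] at h1
    refine ⟨congrArg Fin.val h2, ?_⟩
    by_contra h3
    have h4 : ((c (Fin.castSucc ⟨i, hi⟩) : Fin (k + 1)) : ℕ) < d := not_le.1 h3
    refine h1 ((if_pos rfl).trans ?_)
    rw [zeroProb, if_pos h4, if_pos (h4.trans_le hdk), sub_self]

/-! ### Concentration of the rewards of the random code -/

/-- Jensen's inequality over the channel and the usage: it bounds fluctuations between codewords by
those of the realised counts. -/
theorem energyMean_sq_le {p10 q : ℝ} (hp : p10 ∈ Set.Icc (0 : ℝ) 1) (hq : q ∈ Set.Icc (0 : ℝ) 1)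
    {n : ℕ} (x : Word n) (f : Word n → Word n → ℝ) (a : ℝ) :
    (energyMean p10 q x f - a) ^ 2 ≤ energyMean p10 q x fun y u => (f y u - a) ^ 2 := by
  set μ := energyMean p10 q x f
  have h1 : energyMean p10 q x (fun y u => (f y u - a) ^ 2) =
      energyMean p10 q x (fun y u => (f y u - μ) ^ 2) + (μ - a) ^ 2 := by
    have h2 : (fun y u => (f y u - a) ^ 2) = fun y u => (f y u - μ) ^ 2 +
        (2 * (μ - a) * f y u + ((μ - a) ^ 2 - 2 * (μ - a) * μ)) := by
      ext y u; ring
    rw [h2, energyMean_add, energyMean_add, energyMean_const_mul, energyMean_const]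
    ring
  have h3 : 0 ≤ energyMean p10 q x (fun y u => (f y u - μ) ^ 2) :=
    (energyMean_const p10 q 0 x).ge.trans (energyMean_mono hp hq x fun y u => sq_nonneg _)
  linarith

theorem sq_average_sub_le {M : ℕ} (hM : 0 < M) (a : Fin M → ℝ) (g : ℝ) :
    ((∑ m, a m) / M - g) ^ 2 ≤ (∑ m, (a m - g) ^ 2) / M := by
  have hM' : (0 : ℝ) < M := Nat.cast_pos.2 hM
  have h1 := sq_sum_le_card_mul_sum_sq (s := Finset.univ) (f := fun m => a m - g)
  rw [Finset.sum_sub_distrib] at h1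
  simp only [Finset.sum_const, Finset.card_univ, Fintype.card_fin, nsmul_eq_mul] at h1
  have h2 : (∑ m, a m) / M - g = (∑ m, a m - M * g) / M := by
    field_simp
  rw [h2, div_pow, div_le_div_iff₀ (by positivity) hM']
  nlinarith

section Concentration

variable {d k : ℕ} {p : ℕ → ℝ} {p10 q : ℝ} {Bmax : ℕ} {πB : Fin (Bmax + 1) → ℝ}
  {r : ℕ → ℕ → Bool × Bool × Bool → ℝ}

/-- The rewards have mean linear up to bounded errors, and linear variance. -/
theorem exists_reward_bounds {z : ℕ → ℝ} (hz : ∀ c, z c ∈ Set.Icc (0 : ℝ) 1)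
    (hzk : ∀ c, k ≤ c → z c = 0) (hp : p10 ∈ Set.Icc (0 : ℝ) 1) (hq : q ∈ Set.Icc (0 : ℝ) 1)
    (hst : RenewalInvariant z p10 q k πB) (hπ : πB ∈ stdSimplex ℝ (Fin (Bmax + 1)))
    (hK : ∃ K, ∀ c b ω, |r c b ω| ≤ K)
    (hr : ∀ c b b' a e s, b ≤ Bmax → b' ≤ Bmax → |r c b (a, e, s) - r c b' (a, e, s)| +
      |(batteryStep Bmax b e s : ℝ) - batteryStep Bmax b' e s| ≤ |(b : ℝ) - b'|)
    {g : ℝ} (hg : g = cycleSum z p10 q k πB (slotReward z p10 q r) / cycleLength z k) :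
    ∃ C V, (∀ n c b, |meanReward z p10 q Bmax r n c b - n * g| ≤ C) ∧
      ∀ (n c b : ℕ), blockMean z p10 q c
        (fun x y u : Word n => (rewardSum Bmax r c b x y u - n * g) ^ 2) ≤ n * V := by
  obtain ⟨K, hK⟩ := hK
  subst hg
  have hL : ∀ n c b b', b ≤ Bmax → b' ≤ Bmax →
      |meanReward z p10 q Bmax r n c b - meanReward z p10 q Bmax r n c b'| ≤ Bmax := by
    intro n c b b' hb hb'
    refine (abs_meanReward_sub_le_of_step hz hp hq hr n c b b' hb hb').trans ?_
    have h1 : (b : ℝ) ≤ Bmax := Nat.cast_le.2 hb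
    have h2 : (b' : ℝ) ≤ Bmax := Nat.cast_le.2 hb'
    have h3 : (0 : ℝ) ≤ b := Nat.cast_nonneg b
    have h4 : (0 : ℝ) ≤ b' := Nat.cast_nonneg b'
    rw [abs_sub_le_iff]
    constructor <;> linarith
  have hC := fun n c b => abs_meanReward_sub_linear_le hz hzk hp hq hst hπ hK hL n c b
  exact ⟨_, _, hC, fun n c b => blockMean_sq_rewardSum_sub_le hz hp hq hK hC n c b⟩

variable {π : Fin (k + 1) → ℝ} {C V g : ℝ} {b0 : ℕ} {f : ∀ {n : ℕ}, Word n → ℝ}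

/-- The ensemble mean of the message average is the mean for a single codeword, so the numbers of
messages play no role. -/
theorem tendsto_codebookMean_freq (hπ : π ∈ stdSimplex ℝ (Fin (k + 1)))
    (hC : ∀ n c b, |meanReward (zeroProb d k p) p10 q Bmax r n c b - n * g| ≤ C)
    (hf : ∀ {n : ℕ} (c : ℕ) (x : Word n), f x = energyMean p10 q x (rewardSum Bmax r c b0 x))
    {M : ℕ → ℕ} (hM : ∀ n, 0 < M n) :
    Tendsto (fun n => codebookMean (wordProb d k p π) fun x : Fin (M n) → Word n =>
      (∑ m, f (x m)) / M n / n) atTop (𝓝 g) := by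
  have h1 : ∀ n, (codebookMean (wordProb d k p π) fun x : Fin (M n) → Word n =>
      (∑ m, f (x m)) / M n / n) =
        (∑ c : Fin (k + 1), π c * meanReward (zeroProb d k p) p10 q Bmax r n c b0) / n := by
    intro n
    rw [codebookMean_div, codebookMean_average (sum_wordProb d p hπ n) (hM n)]
    simp only [meanReward, blockMean, wordProb_eq_sum, Finset.sum_mul, Finset.mul_sum]
    rw [Finset.sum_comm]
    congr 1
    refine Finset.sum_congr rfl fun c _ => Finset.sum_congr rfl fun x _ => ?_
    rw [hf c x]
    ring
  simp only [h1]
  have h2 : ∀ n : ℕ, |∑ c : Fin (k + 1), π c * meanReward (zeroProb d k p) p10 q Bmax r n c b0 -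
      n * g| ≤ C := by
    intro n
    have h3 : ∑ c : Fin (k + 1), π c * meanReward (zeroProb d k p) p10 q Bmax r n c b0 - n * g =
        ∑ c : Fin (k + 1), π c * (meanReward (zeroProb d k p) p10 q Bmax r n c b0 - n * g) := by
      simp only [mul_sub, Finset.sum_sub_distrib, ← Finset.sum_mul, hπ.2, one_mul]
    rw [h3]
    calc _ ≤ ∑ c : Fin (k + 1),
          |π c * (meanReward (zeroProb d k p) p10 q Bmax r n c b0 - n * g)| :=
          Finset.abs_sum_le_sum_abs _ _
      _ ≤ ∑ c : Fin (k + 1), π c * C := Finset.sum_le_sum fun c _ => by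
          rw [abs_mul, abs_of_nonneg (hπ.1 c)]
          exact mul_le_mul_of_nonneg_left (hC n c b0) (hπ.1 c)
      _ = C := by rw [← Finset.sum_mul, hπ.2, one_mul]
  rw [tendsto_iff_norm_sub_tendsto_zero]
  refine squeeze_zero' (Eventually.of_forall fun n => norm_nonneg _) ?_
    (tendsto_const_div_atTop_nhds_zero_nat C)
  filter_upwards [eventually_gt_atTop 0] with n hn
  have hn' : (0 : ℝ) < n := Nat.cast_pos.2 hn
  rw [Real.norm_eq_abs, div_sub' hn'.ne', abs_div, abs_of_pos hn']
  exact div_le_div_of_nonneg_right (h2 n) hn'.le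

/-- Convexity twice, over messages and over channel and usage, reduces to the second moment for one
codeword. Independence of the codewords brings no further gain here. -/
theorem codebookMean_sq_freq_sub_le (hpj : ∀ j, d ≤ j → j < k → p j ∈ Set.Ioo (0 : ℝ) 1)
    (hp : p10 ∈ Set.Icc (0 : ℝ) 1) (hq : q ∈ Set.Icc (0 : ℝ) 1)
    (hπ : π ∈ stdSimplex ℝ (Fin (k + 1)))
    (hV : ∀ (n c b : ℕ), blockMean (zeroProb d k p) p10 q c
      (fun x y u : Word n => (rewardSum Bmax r c b x y u - n * g) ^ 2) ≤ n * V)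
    (hf : ∀ {n : ℕ} (c : ℕ) (x : Word n), f x = energyMean p10 q x (rewardSum Bmax r c b0 x))
    {n M : ℕ} (hn : 0 < n) (hM : 0 < M) :
    (codebookMean (wordProb d k p π) fun x : Fin M → Word n =>
      ((∑ m, f (x m)) / M / n - g) ^ 2) ≤ V / n := by
  have hn' : (0 : ℝ) < n := Nat.cast_pos.2 hn
  have hP0 : ∀ x : Word n, 0 ≤ wordProb d k p π x := wordProb_nonneg hpj hπ
  have h1 : ∀ x : Fin M → Word n, ((∑ m, f (x m)) / M / n - g) ^ 2 ≤
      (∑ m, (f (x m) / n - g) ^ 2) / M := by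
    intro x
    rw [div_right_comm, Finset.sum_div]
    exact sq_average_sub_le hM (fun m => f (x m) / n) g
  refine (codebookMean_mono hP0 h1).trans ?_
  rw [codebookMean_average (sum_wordProb d p hπ n) hM fun x => (f x / n - g) ^ 2]
  have h2 : ∀ x : Word n, (f x / n - g) ^ 2 = (f x - n * g) ^ 2 / (n : ℝ) ^ 2 := by
    intro x
    rw [← div_pow, sub_div, mul_div_cancel_left₀ _ hn'.ne']
  simp only [h2, mul_div_assoc', ← Finset.sum_div]
  rw [div_le_div_iff₀ (by positivity) hn']
  have h3 : ∑ x : Word n, wordProb d k p π x * (f x - n * g) ^ 2 ≤ n * V := by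
    simp only [wordProb_eq_sum, Finset.sum_mul]
    rw [Finset.sum_comm]
    calc _ ≤ ∑ c : Fin (k + 1), π c * blockMean (zeroProb d k p) p10 q c
          (fun x y u : Word n => (rewardSum Bmax r c b0 x y u - n * g) ^ 2) := by
          refine Finset.sum_le_sum fun c _ => ?_
          rw [blockMean, Finset.mul_sum]
          refine Finset.sum_le_sum fun x _ => ?_
          rw [mul_assoc, hf c x]
          exact mul_le_mul_of_nonneg_left (mul_le_mul_of_nonneg_left (energyMean_sq_le hp hq x _ _)
            (wordProbFrom_nonneg (zeroProb_mem hpj) _ _)) (hπ.1 c)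
      _ ≤ ∑ c : Fin (k + 1), π c * (n * V) := Finset.sum_le_sum fun c _ =>
          mul_le_mul_of_nonneg_left (hV n c b0) (hπ.1 c)
      _ = n * V := by rw [← Finset.sum_mul, hπ.2, one_mul]
  nlinarith

end Concentration

/-- Error probability of the random code with an optimal threshold. -/
theorem exists_decoder_wordProb {d k : ℕ} {p : ℕ → ℝ}
    (hpj : ∀ j, d ≤ j → j < k → p j ∈ Set.Ioo (0 : ℝ) 1) {p10 q : ℝ}
    (hp : p10 ∈ Set.Icc (0 : ℝ) 1) (hq : q ∈ Set.Icc (0 : ℝ) 1) {π : Fin (k + 1) → ℝ}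
    (hπ : π ∈ stdSimplex ℝ (Fin (k + 1))) {Bmax : ℕ} {V I : ℝ}
    (hV : ∀ (n c b : ℕ), blockMean (zeroProb d k p) p10 q c (fun x y u : Word n =>
      (rewardSum Bmax (infoReward (zeroProb d k p) p10) c b x y u - n * I) ^ 2) ≤ n * V)
    {n M : ℕ} (hM : 0 < M) {ρ t : ℝ} (ht : 0 < t) (hMρ : (M : ℝ) - 1 ≤ 2 ^ ρ)
    (hρ : ρ + 3 * t ≤ n * I) :
    ∃ g : (Fin M → Word n) → Word n → Fin M,
      codebookMean (wordProb d k p π) (fun x => errorProb p10 x (g x)) ≤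
        n * V / t ^ 2 + (k + 2) * (2 : ℝ) ^ (-t) := by
  have hz := zeroProb_mem hpj
  have hP0 : ∀ x : Word n, 0 ≤ wordProb d k p π x := wordProb_nonneg hpj hπ
  -- With `T = 2 ^ (ρ + t)` and `S = 2 ^ t`, the union bound costs `2 ^ (-t)` and the unknown
  -- initial state `(k + 1) * 2 ^ (-t)`. The ratio is tested against `2 ^ (ρ + 2 t)`, whose exponent
  -- lies `t` below the mean `n I`.
  have hT : (0 : ℝ) < 2 ^ (ρ + t) := by positivity
  have hS : (0 : ℝ) < 2 ^ t := by positivity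
  obtain ⟨g, hg⟩ := exists_decoder (φ := metric d k p π p10) hP0 (sum_wordProb d p hπ n)
    (chanProb_nonneg hp) (sum_chanProb p10)
    (fun x y => div_nonneg (Finset.sum_nonneg fun c _ => mul_nonneg
      (mul_nonneg (hπ.1 c) (wordProbFrom_nonneg hz _ _)) (ratio_nonneg hz hp _ _ _)) (hP0 x))
    (sum_wordProb_mul_metric_le hpj hp hπ) hM hT
  refine ⟨g, ?_⟩
  have h1 := metric_lt_prob_le (n := n) (q := q) hpj hp hπ hT hS
  have h2 : ∑ c, π c * blockMean (zeroProb d k p) p10 q c (fun x y _ : Word n =>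
      if ratio (zeroProb d k p) p10 c x y < (2 : ℝ) ^ (ρ + t) * 2 ^ t then 1 else 0) ≤
      n * V / t ^ 2 := by
    rw [← Real.rpow_add two_pos]
    calc _ ≤ ∑ c : Fin (k + 1), π c * (n * V / t ^ 2) := Finset.sum_le_sum fun c _ =>
          mul_le_mul_of_nonneg_left
            (blockMean_ratio_lt_le hz hp hq Bmax c 0 ht (by linarith) (hV n c 0)) (hπ.1 c)
      _ = _ := by rw [← Finset.sum_mul, hπ.2, one_mul]
  have h3 : ((k : ℝ) + 1) / 2 ^ t = (k + 1) * (2 : ℝ) ^ (-t) := by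
    rw [Real.rpow_neg two_pos.le, div_eq_mul_inv]
  have h4 : ((M : ℝ) - 1) / 2 ^ (ρ + t) ≤ (2 : ℝ) ^ (-t) := by
    rw [div_le_iff₀ hT, ← Real.rpow_add two_pos]
    simpa using hMρ
  unfold errorProb
  linarith

/-! ### The number of messages -/

theorem ceil_rpow_pos (ρ : ℝ) : 0 < ⌈(2 : ℝ) ^ ρ⌉₊ := Nat.ceil_pos.2 (by positivity)

theorem tendsto_logb_ceil_rpow {ρ : ℕ → ℝ} {R : ℝ} (hR : 0 ≤ R) (hρ : Tendsto ρ atTop (𝓝 R)) :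
    Tendsto (fun n : ℕ => Real.logb 2 (⌈(2 : ℝ) ^ ((n : ℝ) * ρ n)⌉₊ : ℝ) / n) atTop (𝓝 R) := by
  have h1 : Tendsto (fun n : ℕ => 1 / (n : ℝ) + max 0 (ρ n)) atTop (𝓝 R) := by
    have := (tendsto_const_div_atTop_nhds_zero_nat (1 : ℝ)).add ((tendsto_const_nhds (x := (0 : ℝ))).max hρ)
    rwa [zero_add, max_eq_right hR] at this
  refine tendsto_of_tendsto_of_tendsto_of_le_of_le' hρ h1 ?_ ?_
  · filter_upwards [eventually_gt_atTop 0] with n hn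
    have hn' : (0 : ℝ) < n := Nat.cast_pos.2 hn
    rw [le_div_iff₀ hn', mul_comm, Real.le_logb_iff_rpow_le one_lt_two
      (Nat.cast_pos.2 (ceil_rpow_pos _))]
    exact Nat.le_ceil _
  · filter_upwards [eventually_gt_atTop 0] with n hn
    have hn' : (0 : ℝ) < n := Nat.cast_pos.2 hn
    rw [div_le_iff₀ hn', add_mul, one_div_mul_cancel hn'.ne', Real.logb_le_iff_le_rpow one_lt_two
      (Nat.cast_pos.2 (ceil_rpow_pos _)), Real.rpow_add two_pos, Real.rpow_one]
    have h2 : (2 : ℝ) ^ ((n : ℝ) * ρ n) ≤ 2 ^ (max 0 (ρ n) * n) :=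
      Real.rpow_le_rpow_of_exponent_le one_le_two (by
        rw [mul_comm]; exact mul_le_mul_of_nonneg_right (le_max_right _ _) hn'.le)
    have h3 : (1 : ℝ) ≤ 2 ^ (max 0 (ρ n) * n) :=
      Real.one_le_rpow one_le_two (mul_nonneg (le_max_left _ _) hn'.le)
    have h4 := Nat.ceil_lt_add_one (a := (2 : ℝ) ^ ((n : ℝ) * ρ n)) (by positivity)
    linarith

/-- The rate is constant below `I`; at `R = I` it backs off by `3 τ`, which vanishes in the limit.
-/
theorem exists_rates {R I : ℝ} (hRI : R ≤ I) {τ : ℕ → ℝ} (hτ : Tendsto τ atTop (𝓝 0)) :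
    ∃ ρ : ℕ → ℝ, Tendsto ρ atTop (𝓝 R) ∧ (R < I → ∀ n, ρ n = R) ∧
      ∀ᶠ n in atTop, ρ n + 3 * τ n ≤ I := by
  have h3 : Tendsto (fun n => 3 * τ n) atTop (𝓝 0) := by simpa using hτ.const_mul 3
  rcases hRI.lt_or_eq with h | h
  · refine ⟨fun _ => R, tendsto_const_nhds, fun _ _ => rfl, ?_⟩
    filter_upwards [h3.eventually (eventually_lt_nhds (sub_pos.2 h))] with n hn
    linarith
  · refine ⟨fun n => I - 3 * τ n, ?_, fun h' => absurd h h'.ne, Eventually.of_forall fun n => ?_⟩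
    · rw [h]
      simpa using h3.const_sub I
    · linarith

/-! ### Vanishing error probability and the choice of deterministic codes. -/

theorem tendsto_of_tendsto_sq_le {a η : ℕ → ℝ} {g : ℝ} (h : ∀ n, (a n - g) ^ 2 ≤ η n)
    (hη : Tendsto η atTop (𝓝 0)) : Tendsto a atTop (𝓝 g) := by
  have h1 : Tendsto (fun n => √(η n)) atTop (𝓝 0) := by
    have h2 := (Real.continuous_sqrt.tendsto 0).comp hη
    rwa [Real.sqrt_zero] at h2
  rw [tendsto_iff_norm_sub_tendsto_zero]
  exact squeeze_zero (fun n => norm_nonneg _) (fun n => Real.abs_le_sqrt (h n)) h1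

theorem errorProb_nonneg {p10 : ℝ} (hp : p10 ∈ Set.Icc (0 : ℝ) 1) {M n : ℕ} (x : Fin M → Word n)
    (g : Word n → Fin M) : 0 ≤ errorProb p10 x g := by
  refine div_nonneg (Finset.sum_nonneg fun m _ => Finset.sum_nonneg fun y _ => ?_)
    (Nat.cast_nonneg M)
  split_ifs
  · exact le_rfl
  · exact chanProb_nonneg hp _ _

/-- Random coding at rates up to `I`, the mean information density of a slot. -/
theorem exists_decoders_tendsto {d k : ℕ} {p : ℕ → ℝ}
    (hpj : ∀ j, d ≤ j → j < k → p j ∈ Set.Ioo (0 : ℝ) 1) {p10 q : ℝ}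
    (hp : p10 ∈ Set.Icc (0 : ℝ) 1) (hq : q ∈ Set.Icc (0 : ℝ) 1) {π : Fin (k + 1) → ℝ}
    (hπ : π ∈ stdSimplex ℝ (Fin (k + 1))) {Bmax : ℕ} {V I R : ℝ} (hRI : R ≤ I)
    (hV : ∀ (n c b : ℕ), blockMean (zeroProb d k p) p10 q c (fun x y u : Word n =>
      (rewardSum Bmax (infoReward (zeroProb d k p) p10) c b x y u - n * I) ^ 2) ≤ n * V) :
    ∃ ρ : ℕ → ℝ, Tendsto ρ atTop (𝓝 R) ∧ (R < I → ∀ n, ρ n = R) ∧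
      ∃ g : ∀ n : ℕ, (Fin ⌈(2 : ℝ) ^ ((n : ℝ) * ρ n)⌉₊ → Word n) → Word n →
        Fin ⌈(2 : ℝ) ^ ((n : ℝ) * ρ n)⌉₊,
      Tendsto (fun n => codebookMean (wordProb d k p π) fun x => errorProb p10 x (g n x))
        atTop (𝓝 0) := by
  -- The deviation `t = n τ n = n ^ (3/4)` is `o(n)`, so no rate is lost, but exceeds the scale `√n`
  -- of the fluctuations, so the Chebyshev term is of order `n ^ (-1/2)`.
  set τ : ℕ → ℝ := fun n => (n : ℝ) ^ (-(1 / 4 : ℝ)) with hτdef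
  have hτ : Tendsto τ atTop (𝓝 0) :=
    (tendsto_rpow_neg_atTop (by norm_num)).comp tendsto_natCast_atTop_atTop
  have hτpos : ∀ n : ℕ, 0 < n → 0 < τ n := fun n hn => Real.rpow_pos_of_pos (Nat.cast_pos.2 hn) _
  have hnτ : Tendsto (fun n : ℕ => (n : ℝ) * τ n) atTop atTop := by
    have h1 : Tendsto (fun n : ℕ => (n : ℝ) ^ (3 / 4 : ℝ)) atTop atTop :=
      (tendsto_rpow_atTop (by norm_num)).comp tendsto_natCast_atTop_atTop
    refine h1.congr' ?_
    filter_upwards [eventually_gt_atTop 0] with n hn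
    have hn' : (0 : ℝ) < n := Nat.cast_pos.2 hn
    rw [hτdef, ← Real.rpow_one_add' hn'.le (by norm_num)]
    norm_num
  have hvar : Tendsto (fun n : ℕ => n * V / (n * τ n) ^ 2) atTop (𝓝 0) := by
    have h1 : Tendsto (fun n : ℕ => V * (n : ℝ) ^ (-(1 / 2 : ℝ))) atTop (𝓝 0) := by
      simpa using ((tendsto_rpow_neg_atTop (y := 1 / 2) (by norm_num)).comp
        tendsto_natCast_atTop_atTop).const_mul V
    refine h1.congr' ?_
    filter_upwards [eventually_gt_atTop 0] with n hn
    have hn' : (0 : ℝ) < n := Nat.cast_pos.2 hn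
    have h2 : ((n : ℝ) * τ n) ^ 2 = n * n ^ (1 / 2 : ℝ) := by
      rw [hτdef, mul_pow, ← Real.rpow_natCast, ← Real.rpow_natCast ((n : ℝ) ^ _), ← Real.rpow_mul hn'.le,
        ← Real.rpow_add hn', ← Real.rpow_one_add' hn'.le (by norm_num)]
      norm_num
    rw [h2, mul_div_mul_left _ _ hn'.ne', Real.rpow_neg hn'.le, ← div_eq_mul_inv]
  have hexp : Tendsto (fun n : ℕ => ((k : ℝ) + 2) * (2 : ℝ) ^ (-((n : ℝ) * τ n))) atTop (𝓝 0) := by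
    have h1 : Tendsto (fun t : ℝ => (2 : ℝ) ^ (-t)) atTop (𝓝 0) := by
      have h2 := tendsto_rpow_atTop_of_base_lt_one (2⁻¹ : ℝ) (by norm_num) (by norm_num)
      refine h2.congr fun t => ?_
      rw [Real.inv_rpow two_pos.le, Real.rpow_neg two_pos.le]
    simpa using (h1.comp hnτ).const_mul ((k : ℝ) + 2)
  obtain ⟨ρ, hρ, hρR, hρI⟩ := exists_rates hRI hτ
  refine ⟨ρ, hρ, hρR, ?_⟩
  have key : ∀ n : ℕ, ∃ g : (Fin ⌈(2 : ℝ) ^ ((n : ℝ) * ρ n)⌉₊ → Word n) → Word n →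
      Fin ⌈(2 : ℝ) ^ ((n : ℝ) * ρ n)⌉₊, 0 < n → ρ n + 3 * τ n ≤ I →
      codebookMean (wordProb d k p π) (fun x => errorProb p10 x (g x)) ≤
        n * V / (n * τ n) ^ 2 + (k + 2) * (2 : ℝ) ^ (-((n : ℝ) * τ n)) := by
    intro n
    have hM : 0 < ⌈(2 : ℝ) ^ ((n : ℝ) * ρ n)⌉₊ := ceil_rpow_pos _
    by_cases h : 0 < n ∧ ρ n + 3 * τ n ≤ I
    · have hn' : (0 : ℝ) < n := Nat.cast_pos.2 h.1
      obtain ⟨g, hg⟩ := exists_decoder_wordProb hpj hp hq hπ hV hM (ρ := n * ρ n)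
        (mul_pos hn' (hτpos n h.1))
        (by
          have := Nat.ceil_lt_add_one (a := (2 : ℝ) ^ ((n : ℝ) * ρ n)) (by positivity)
          linarith)
        (by nlinarith [h.2])
      exact ⟨g, fun _ _ => hg⟩
    · exact ⟨fun _ _ => ⟨0, hM⟩, fun h1 h2 => absurd ⟨h1, h2⟩ h⟩
  choose g hg using key
  refine ⟨g, squeeze_zero' (Eventually.of_forall fun n => ?_) ?_ (by simpa using hvar.add hexp)⟩
  · exact Finset.sum_nonneg fun x _ => mul_nonneg
      (Finset.prod_nonneg fun m _ => wordProb_nonneg hpj hπ _) (errorProb_nonneg hp _ _)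
  · filter_upwards [eventually_gt_atTop 0, hρI] with n hn hn'
    exact hg n hn hn'

/-- Good codebooks exist as soon as the random codebook is good in mean square. -/
theorem codesAchieve_of_codebookMean {d k : ℕ} (hdk : d ≤ k) {p : ℕ → ℝ}
    (hpj : ∀ j, d ≤ j → j < k → p j ∈ Set.Ioo (0 : ℝ) 1) {p10 q : ℝ}
    (hp : p10 ∈ Set.Icc (0 : ℝ) 1) {π : Fin (k + 1) → ℝ}
    (hπ : π ∈ stdSimplex ℝ (Fin (k + 1))) {Bmax b0 : ℕ} {M : ℕ → ℕ} {ō ū Pof Puf : ℝ}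
    (g : ∀ n, (Fin (M n) → Word n) → Word n → Fin (M n))
    (he : Tendsto (fun n => codebookMean (wordProb d k p π) fun x => errorProb p10 x (g n x))
      atTop (𝓝 0))
    (ho : Tendsto (fun n => codebookMean (wordProb d k p π) fun x : Fin (M n) → Word n =>
      (overflowFreq p10 q Bmax b0 x - ō) ^ 2) atTop (𝓝 0))
    (hu : Tendsto (fun n => codebookMean (wordProb d k p π) fun x : Fin (M n) → Word n =>
      (underflowFreq p10 q Bmax b0 x - ū) ^ 2) atTop (𝓝 0))
    (hof : ō ≤ Pof) (huf : ū ≤ Puf) : CodesAchieve d k p10 q Bmax b0 M Pof Puf := by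
  -- Squared deviations make all three terms nonnegative, so a small sum controls each of them
  -- separately in a single codebook.
  have hF := he.add (ho.add hu)
  simp only [← codebookMean_add, add_zero] at hF
  choose x hx hxF using fun n => exists_le_codebookMean (M := M n) (P := wordProb d k p π)
    (wordProb_nonneg hpj hπ) (sum_wordProb d p hπ n) fun x => errorProb p10 x (g n x) +
      ((overflowFreq p10 q Bmax b0 x - ō) ^ 2 + (underflowFreq p10 q Bmax b0 x - ū) ^ 2)
  have he0 := fun n => errorProb_nonneg hp (x n) (g n (x n))
  have h1 : Tendsto (fun n => overflowFreq p10 q Bmax b0 (x n)) atTop (𝓝 ō) :=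
    tendsto_of_tendsto_sq_le (fun n => by
      have := hxF n
      have := he0 n
      have := sq_nonneg (underflowFreq p10 q Bmax b0 (x n) - ū)
      linarith) hF
  have h2 : Tendsto (fun n => underflowFreq p10 q Bmax b0 (x n)) atTop (𝓝 ū) :=
    tendsto_of_tendsto_sq_le (fun n => by
      have := hxF n
      have := he0 n
      have := sq_nonneg (overflowFreq p10 q Bmax b0 (x n) - ō)
      linarith) hF
  refine ⟨x, fun n => g n (x n), fun n m => isRLL_of_wordProb_pos hdk (hx n m),
    squeeze_zero he0 (fun n => ?_) hF, h1.limsup_eq.trans_le hof, h2.limsup_eq.trans_le huf⟩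
  have := hxF n
  have := sq_nonneg (overflowFreq p10 q Bmax b0 (x n) - ō)
  have := sq_nonneg (underflowFreq p10 q Bmax b0 (x n) - ū)
  linarith

theorem meanOverflows_eq_energyMean_rewardSum (p10 q : ℝ) (Bmax b : ℕ) {n : ℕ} (c : ℕ)
    (x : Word n) : meanOverflows p10 q Bmax b x =
      energyMean p10 q x (rewardSum Bmax (fun _ b ω => overflowReward Bmax b ω.2.1 ω.2.2) c b x) := by
  simp only [meanOverflows, overflowCount_eq_rewardSum Bmax c b x]

theorem meanUnderflows_eq_energyMean_rewardSum (p10 q : ℝ) (Bmax b : ℕ) {n : ℕ} (c : ℕ)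
    (x : Word n) : meanUnderflows p10 q Bmax b x =
      energyMean p10 q x (rewardSum Bmax (fun _ b ω => underflowReward b ω.2.1 ω.2.2) c b x) := by
  simp only [meanUnderflows, underflowCount_eq_rewardSum Bmax c b x]

end EnergyRLL

/-! ### Assembly of the result. -/

theorem proposition1 (d k : ℕ) (hdk : d ≤ k) (Bmax : ℕ) (hB : 1 ≤ Bmax)
    (p10 q : ℝ) (hp10 : p10 ∈ Set.Icc (0 : ℝ) 1) (hq : q ∈ Set.Icc (0 : ℝ) 1)
    (b0 : ℕ) (hb0 : b0 ≤ Bmax)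
    (p : ℕ → ℝ) (hp : ∀ j, d ≤ j → j < k → p j ∈ Set.Ioo (0 : ℝ) 1) :
    -- the steady-state distributions exist, and that of the code is unique
    (∃! π : Fin (k + 1) → ℝ, IsStationaryDist (codeTrans d k p) π) ∧
    (∃ πB : Fin (Bmax + 1) → ℝ, IsStationaryDist (renewalTrans d k p p10 q Bmax) πB) ∧
    -- the expected numbers of overflows and underflows in a renewal interval
    renewalOverflows d k p p10 q Bmax Bmax =
      ∑ i ∈ Finset.Icc (d + 1) (k + 1), intervalProb d k p i * ((1 - p10) * binom 0 i q) ∧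
    (∀ b ≤ Bmax, renewalUnderflows d k p p10 q Bmax b =
      ∑ i ∈ Finset.Icc (d + 1) (k + 1), intervalProb d k p i *
        ((1 - p10) * ∑ l ∈ Finset.Icc 1 (i - b - 1), (l : ℝ) * binom (l + b) (i - 1) q +
          p10 * ∑ l ∈ Finset.Icc 1 (i - b), (l : ℝ) * binom (l + b) i q)) ∧
    ∀ (π : Fin (k + 1) → ℝ) (πB : Fin (Bmax + 1) → ℝ),
      IsStationaryDist (codeTrans d k p) π →
      IsStationaryDist (renewalTrans d k p p10 q Bmax) πB →
      -- the probabilities of overflow and underflow of the random code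
      (∀ M : ℕ → ℕ, (∀ n, 0 < M n) →
        ensembleOverflowProb d k p π p10 q Bmax b0 M = overflowBound d k p p10 q Bmax πB ∧
        ensembleUnderflowProb d k p π p10 q Bmax b0 M = underflowBound d k p p10 q Bmax πB) ∧
      -- achievability
      ∀ R Pof Puf : ℝ, 0 ≤ R → R ≤ rateBound d k p π p10 →
        overflowBound d k p p10 q Bmax πB ≤ Pof →
        underflowBound d k p p10 q Bmax πB ≤ Puf →
        ∃ M : ℕ → ℕ,
          Tendsto (fun n => Real.logb 2 (M n) / n) atTop (𝓝 R) ∧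
          (R < rateBound d k p π p10 → ∀ n : ℕ, M n = ⌈(2 : ℝ) ^ ((n : ℝ) * R)⌉₊) ∧
          RandomCodeAchieves d k p π p10 q Bmax b0 M Pof Puf ∧
          CodesAchieve d k p10 q Bmax b0 M Pof Puf := by
  have hz : ∀ c, zeroProb d k p c ∈ Set.Icc (0 : ℝ) 1 := zeroProb_mem hp
  have hzk : ∀ c, k ≤ c → zeroProb d k p c = 0 := fun c h => zeroProb_of_le p h
  refine ⟨⟨fun c => survival (zeroProb d k p) c / cycleLength (zeroProb d k p) k,
      (isStationaryDist_codeTrans_iff hp _).2 fun _ => rfl, fun π hπ =>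
      funext ((isStationaryDist_codeTrans_iff hp π).1 hπ)⟩,
    exists_isStationaryDist_renewalTrans hdk hp Bmax hp10 hq,
    renewalOverflows_top hdk p p10 q hB,
    fun b hb => renewalUnderflows_formula hdk p p10 q hb, fun π πB hπ hπB => ?_⟩
  have hst := renewalInvariant_of_isStationaryDist hdk hπB
  obtain ⟨Co, Vo, hCo, hVo⟩ := exists_reward_bounds hz hzk hp10 hq hst hπB.1
    ⟨1, fun c b ω => by unfold overflowReward; split_ifs <;> simp⟩
    (fun c b b' a e s hb hb' => abs_overflowReward_sub_add_le Bmax b b' e s hb hb')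
    (overflowBound_eq_cycle hdk p p10 q πB)
  obtain ⟨Cu, Vu, hCu, hVu⟩ := exists_reward_bounds hz hzk hp10 hq hst hπB.1
    ⟨1, fun c b ω => by unfold underflowReward; split_ifs <;> simp⟩
    (fun c b b' a e s hb hb' => abs_underflowReward_sub_add_le Bmax b b' e s hb hb')
    (underflowBound_eq_cycle hdk p p10 q πB)
  obtain ⟨-, Vi, -, hVi⟩ := exists_reward_bounds hz hzk hp10 hq hst hπB.1
    (exists_infoReward_bound (p10 := p10) hzk)
    -- The information density does not depend on the battery, so only the contraction of the
    -- battery step remains; it is contained in the overflow estimate.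
    (fun c b b' a e s hb hb' => by
      have h1 := abs_overflowReward_sub_add_le Bmax b b' e s hb hb'
      have h2 := abs_nonneg (overflowReward Bmax b e s - overflowReward Bmax b' e s)
      simp only [infoReward, sub_self, abs_zero]
      linarith)
    (rateBound_eq_cycle hp hp10 hπ hπB.1)
  have hof : ∀ M : ℕ → ℕ, (∀ n, 0 < M n) →
      Tendsto (fun n => codebookMean (wordProb d k p π) fun x : Fin (M n) → Word n =>
        overflowFreq p10 q Bmax b0 x) atTop (𝓝 (overflowBound d k p p10 q Bmax πB)) :=
    fun M hM => tendsto_codebookMean_freq (f := meanOverflows p10 q Bmax b0) hπ.1 hCo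
      (meanOverflows_eq_energyMean_rewardSum p10 q Bmax b0) hM
  have huf : ∀ M : ℕ → ℕ, (∀ n, 0 < M n) →
      Tendsto (fun n => codebookMean (wordProb d k p π) fun x : Fin (M n) → Word n =>
        underflowFreq p10 q Bmax b0 x) atTop (𝓝 (underflowBound d k p p10 q Bmax πB)) :=
    fun M hM => tendsto_codebookMean_freq (f := meanUnderflows p10 q Bmax b0) hπ.1 hCu
      (meanUnderflows_eq_energyMean_rewardSum p10 q Bmax b0) hM
  have hP0 : ∀ {n : ℕ} (x : Word n), 0 ≤ wordProb d k p π x := wordProb_nonneg hp hπ.1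
  refine ⟨fun M hM => ⟨(hof M hM).limsup_eq, (huf M hM).limsup_eq⟩,
    fun R Pof Puf hR hRI hPof hPuf => ?_⟩
  obtain ⟨ρ, hρ, hρR, g, hg⟩ := exists_decoders_tendsto hp hp10 hq hπ.1 hRI hVi
  have hM : ∀ n : ℕ, 0 < ⌈(2 : ℝ) ^ ((n : ℝ) * ρ n)⌉₊ := fun n => ceil_rpow_pos _
  refine ⟨fun n => ⌈(2 : ℝ) ^ ((n : ℝ) * ρ n)⌉₊, tendsto_logb_ceil_rpow hR hρ,
    fun h n => by simp only [hρR h n], ⟨⟨g, hg⟩, (hof _ hM).limsup_eq.trans_le hPof,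
      (huf _ hM).limsup_eq.trans_le hPuf⟩,
    codesAchieve_of_codebookMean hdk hp hp10 hπ.1 g hg ?_ ?_ hPof hPuf⟩
  · refine squeeze_zero' (Eventually.of_forall fun n => ?_) ?_
      (tendsto_const_div_atTop_nhds_zero_nat Vo)
    · exact Finset.sum_nonneg fun x _ => mul_nonneg (Finset.prod_nonneg fun m _ => hP0 _)
        (sq_nonneg _)
    · filter_upwards [eventually_gt_atTop 0] with n hn
      exact codebookMean_sq_freq_sub_le (f := meanOverflows p10 q Bmax b0) hp hp10 hq hπ.1 hVo
        (meanOverflows_eq_energyMean_rewardSum p10 q Bmax b0) hn (hM n)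
  · refine squeeze_zero' (Eventually.of_forall fun n => ?_) ?_
      (tendsto_const_div_atTop_nhds_zero_nat Vu)
    · exact Finset.sum_nonneg fun x _ => mul_nonneg (Finset.prod_nonneg fun m _ => hP0 _)
        (sq_nonneg _)
    · filter_upwards [eventually_gt_atTop 0] with n hn
      exact codebookMean_sq_freq_sub_le (f := meanUnderflows p10 q Bmax b0) hp hp10 hq hπ.1 hVu
        (meanUnderflows_eq_energyMean_rewardSum p10 q Bmax b0) hn (hM n)
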